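/- Let $Q$ be a finite toupie quiver: it has exactly one source $0$ and exactly one sink $\omega$, every other vertex is the source of exactly one arrow and the target of exactly one arrow, and $Q$ has no oriented cycles. Let $I$ be an admissible ideal of the path algebra $\mathbb{C}Q$ and $A=\mathbb{C}Q/I$. A branch is a path from $0$ to $\omega$; fix a total order of the branches. Let $\alpha^{(1)},\dots,\alpha^{(a)}$ be the arrows from $0$ to $\omega$, and assume $a\ge 1$. The reduced relations are the rows of the reduced row echelon form (for the chosen order) of the space of all linear combinations of branches that lie in $I$; a branch is irreducible if it is not the leading term of an element of this space. A branch contains a monomial relation if one of its subpaths lies in $I$. Let $Q_\rho$ be the graph whose vertices are the branches of length at least $2$ that contain no monomial relation, two different ones being adjacent if some reduced relation involves both, and let $Q_\rho^1,\dots,Q_\rho^r$ be its connected components. For an arrow $\beta$ and an element $b\in A$ parallel to it, let $\beta\|b$ be the cochain on arrows with $\beta\mapsto b$ and all other arrows mapped to $0$. Such a cochain $g$ is a cocycle if it extends to a Hochschild $1$-cocycle (a derivation) of $A$ that vanishes on the idempotents $e_x$ of the vertices; it then defines a class in $HH^1(A)$, which is a Lie algebra under the Gerstenhaber bracket $[f,g]=f\circ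 g-g\circ f$. Write $\alpha_0$ for the first arrow of a branch $\alpha$, and put $$t_h=\sum_{\alpha\in Q_\rho^h}\alpha_0\|\alpha_0,\qquad z_{us}=\alpha^{(u)}\|\alpha^{(s)},\qquad C''_1=\{\alpha_0\|\alpha_0:\ \alpha \text{ a branch that contains a monomial relation}\},$$ where $1\le h\le r$, $1\le u\le a$ and $\alpha^{(s)}$ runs over the irreducible branches of length at least $2$. All these cochains, and the cochains $\theta_M=\sum_{p,q=1}^{a}M_{qp}\,\alpha^{(p)}\|\alpha^{(q)}$ for $M\in \mathfrak{sl}_a(\mathbb{C})$, are cocycles. The same symbols denote their classes in $HH^1(A)$. Then the span $L$ of all $t_h$ and $z_{us}$ is a solvable Lie ideal of $HH^1(A)$. Moreover: 1. $S_1=\langle t_h\rangle$ is an abelian Lie subalgebra, $L_2=\langle z_{us}\rangle$ is an abelian Lie ideal of $HH^1(A)$, and $L=S_1\ltimes L_2$, i.e. $(t,z)\mapsto t+z$ is an isomorphism from a semidirect product $S_1\ltimes L_2$ onto $L$. 2. $\langle C''_1\rangle$ is an abelian Lie ideal of $HH^1(A)$, and there is an isomorphism of Lie algebras $$HH^1(A)\;\cong\;\langle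 C''_1\rangle\oplus\bigl(\mathfrak{sl}_a(\mathbb{C})\ltimes(S_1\ltimes L_2)\bigr),$$ for a suitable action of $\mathfrak{sl}_a(\mathbb{C})$ on $S_1\ltimes L_2$ by derivations; under it the element $(y,M,t,z)$ of the right-hand side corresponds to $y+\theta_M+t+z$. -/

import Mathlib

attribute [local instance 100] LieRing.ofAssociativeRing

noncomputable section

namespace Toupie

/-! ## Path algebras of finite quivers -/

/-- The type of all arrows of a quiver. -/
abbrev Arrow (V : Type*) [Quiver V] := Σ x y : V, x ⟶ y

/-- The type of all paths of a quiver, the trivial ones included. -/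
abbrev QPath (V : Type*) [Quiver V] := Σ x y : V, Quiver.Path x y

/-- The underlying vector space of the path algebra: it has the paths of `V` as a basis. -/
def PathAlgebra (k : Type*) (V : Type*) [Quiver V] [CommRing k] := QPath V →₀ k

namespace PathAlgebra

variable {k : Type*} {V : Type*} [Quiver V] [CommRing k]

instance : AddCommGroup (PathAlgebra k V) := inferInstanceAs (AddCommGroup (QPath V →₀ k))

instance : Module k (PathAlgebra k V) := inferInstanceAs (Module k (QPath V →₀ k))

/-- The coefficient of `f` at the path `p`. -/
def coeff (f : PathAlgebra k V) (p : QPath V) : k := (show QPath V →₀ k from f) p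

/-- The basis element of the path algebra given by a path. -/
def ofPath (p : QPath V) : PathAlgebra k V := (Finsupp.single p 1 : QPath V →₀ k)

theorem induction_path {P : PathAlgebra k V → Prop} (h0 : P 0)
    (hadd : ∀ f g, P f → P g → P (f + g)) (hs : ∀ (c : k) (p : QPath V), P (c • ofPath p))
    (f : PathAlgebra k V) : P f := by
  refine Finsupp.induction_linear (motive := P) f h0 hadd fun p c => ?_
  have h := hs c p
  have e : c • ofPath p = (Finsupp.single p c : QPath V →₀ k) := by
    unfold ofPath
    exact (Finsupp.smul_single_one p c)
  exact e ▸ h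

open Classical in
/-- The product of two paths: `pq` is the path "first `p`, then `q`" if `q` starts where `p` ends,
and `0` otherwise. -/
def mulPath (p q : QPath V) : PathAlgebra k V :=
  if h : q.1 = p.2.1 then ofPath ⟨p.1, q.2.1, p.2.2.comp (q.2.2.cast h rfl)⟩ else 0

/-- The bilinear extension of the product of paths. -/
def mulLin : PathAlgebra k V →ₗ[k] PathAlgebra k V →ₗ[k] PathAlgebra k V :=
  Finsupp.linearCombination k fun p : QPath V =>
    (Finsupp.linearCombination k fun q : QPath V => (mulPath p q : PathAlgebra k V))

theorem mulLin_ofPath (p q : QPath V) :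
    mulLin (k := k) (ofPath p) (ofPath q) = mulPath p q := by
  unfold mulLin ofPath
  erw [Finsupp.linearCombination_single, one_smul, Finsupp.linearCombination_single, one_smul]

theorem mulLin_assoc (f g h : PathAlgebra k V) :
    mulLin (mulLin f g) h = mulLin f (mulLin g h) := by
  induction f using induction_path with
  | h0 => simp
  | hadd f f' hf hf' => simp only [map_add, LinearMap.add_apply, hf, hf']
  | hs c p =>
  induction g using induction_path with
  | h0 => simp
  | hadd f f' hf hf' => simp only [map_add, LinearMap.add_apply, hf, hf']
  | hs d q =>
  induction h using induction_path with
  | h0 => simp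
  | hadd f f' hf hf' => simp only [map_add, hf, hf']
  | hs e r =>
  simp only [map_smul, LinearMap.smul_apply, mulLin_ofPath]
  suffices H : mulLin (k := k) (mulPath p q) (ofPath r) = mulLin (ofPath p) (mulPath q r) by
    rw [H]
  obtain ⟨p₁, p₂, p⟩ := p
  obtain ⟨q₁, q₂, q⟩ := q
  obtain ⟨r₁, r₂, r⟩ := r
  by_cases h₁ : q₁ = p₂
  · subst h₁
    by_cases h₂ : r₁ = q₂
    · subst h₂
      simp [mulPath, mulLin_ofPath]
    · simp [mulPath, mulLin_ofPath, h₂]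
  · by_cases h₂ : r₁ = q₂
    · subst h₂
      simp [mulPath, mulLin_ofPath, h₁]
    · simp [mulPath, h₁, h₂]

/-- The idempotent `e_x` of a vertex `x`, i.e. the trivial path at `x`. -/
def vertex (x : V) : PathAlgebra k V := ofPath ⟨x, x, Quiver.Path.nil⟩

/-- An arrow, as an element of the path algebra. -/
def arrow (α : Arrow V) : PathAlgebra k V := ofPath ⟨α.1, α.2.1, α.2.2.toPath⟩

variable [Fintype V]

instance : Mul (PathAlgebra k V) := ⟨fun f g => mulLin f g⟩

instance : One (PathAlgebra k V) := ⟨∑ x : V, vertex x⟩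

theorem mul_def (f g : PathAlgebra k V) : f * g = mulLin f g := rfl

theorem one_def : (1 : PathAlgebra k V) = ∑ x : V, vertex x := rfl

theorem one_mul' (f : PathAlgebra k V) : 1 * f = f := by
  classical
  induction f using induction_path with
  | h0 => simp [mul_def]
  | hadd f f' hf hf' => rw [mul_def, map_add, ← mul_def, ← mul_def, hf, hf']
  | hs c p =>
    obtain ⟨p₁, p₂, p⟩ := p
    rw [mul_def, map_smul, one_def, map_sum, LinearMap.sum_apply]
    congr 1
    simp only [vertex, mulLin_ofPath]
    rw [Finset.sum_eq_single p₁]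
    · simp [mulPath]
    · intro b _ hb
      simp [mulPath, hb.symm]
    · simp

theorem mul_one' (f : PathAlgebra k V) : f * 1 = f := by
  classical
  induction f using induction_path with
  | h0 => simp [mul_def]
  | hadd f f' hf hf' =>
    rw [mul_def, map_add, LinearMap.add_apply, ← mul_def, ← mul_def, hf, hf']
  | hs c p =>
    obtain ⟨p₁, p₂, p⟩ := p
    rw [mul_def, map_smul, LinearMap.smul_apply, one_def, map_sum]
    congr 1
    simp only [vertex, mulLin_ofPath]
    rw [Finset.sum_eq_single p₂]
    · simp [mulPath]
    · intro b _ hb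
      simp [mulPath, hb]
    · simp

instance : Ring (PathAlgebra k V) where
  __ := (inferInstance : AddCommGroup (PathAlgebra k V))
  left_distrib f g h := map_add (mulLin f) g h
  right_distrib f g h := by simp [mul_def]
  zero_mul f := by simp [mul_def]
  mul_zero f := by simp [mul_def]
  mul_assoc := mulLin_assoc
  one_mul := one_mul'
  mul_one := mul_one'

instance : Algebra k (PathAlgebra k V) :=
  Algebra.ofModule (fun c f g => by simp [mul_def]) (fun c f g => by simp [mul_def])

end PathAlgebra

/-! ## The first Hochschild cohomology of an algebra, with its Gerstenhaber bracket -/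

section Hochschild

variable (k : Type*) [CommRing k] (A : Type*) [Ring A] [Algebra k A]

/-- The Hochschild differential `A → Hom(A, A)`, `m ↦ (x ↦ x m - m x)`. -/
def hochschildD0 : A →ₗ[k] Module.End k A :=
  (LinearMap.mul k A).flip - LinearMap.mul k A

/-- The Hochschild differential `Hom(A, A) → Hom(A ⊗ A, A)`,
`f ↦ (x ⊗ y ↦ x f(y) - f(x y) + f(x) y)`; bilinear maps are written in curried form. -/
def hochschildD1 : Module.End k A →ₗ[k] (A →ₗ[k] A →ₗ[k] A) where
  toFun f := LinearMap.mk₂ k (fun x y => x * f y - f (x * y) + f x * y)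
    (fun x y z => by simp only [add_mul, map_add]; abel)
    (fun c x y => by simp [smul_sub, smul_add])
    (fun x y z => by simp only [mul_add, map_add]; abel)
    (fun c x y => by simp [smul_sub, smul_add])
  map_add' f g := by
    ext x y
    simp only [LinearMap.mk₂_apply, LinearMap.add_apply, mul_add, add_mul]
    abel
  map_smul' c f := by
    ext x y
    simp [smul_sub, smul_add]

variable {k A} in
theorem hochschildD1_apply (f : Module.End k A) (x y : A) :
    hochschildD1 k A f x y = x * f y - f (x * y) + f x * y := rfl

variable {k A} in
theorem mem_ker_hochschildD1 (f : Module.End k A) :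
    f ∈ LinearMap.ker (hochschildD1 k A) ↔ ∀ x y, f (x * y) = x * f y + f x * y := by
  constructor
  · intro h x y
    have h1 : x * f y - f (x * y) + f x * y = 0 :=
      LinearMap.congr_fun₂ (LinearMap.mem_ker.1 h) x y
    have h2 : (x * f y + f x * y) - f (x * y) = 0 := by rw [← h1]; abel
    exact (sub_eq_zero.1 h2).symm
  · intro h
    refine LinearMap.mem_ker.2 (LinearMap.ext₂ fun x y => ?_)
    rw [hochschildD1_apply, h]
    simp

/-- Hochschild 1-cocycles; the bracket is the Gerstenhaber bracket `[f, g] = f ∘ g - g ∘ f`. -/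
def Cocycles1 : LieSubalgebra k (Module.End k A) where
  __ := LinearMap.ker (hochschildD1 k A)
  lie_mem' {f g} hf hg := by
    have hf' := (mem_ker_hochschildD1 f).1 hf
    have hg' := (mem_ker_hochschildD1 g).1 hg
    refine (mem_ker_hochschildD1 ⁅f, g⁆).2 fun x y => ?_
    simp only [Ring.lie_def, LinearMap.sub_apply, Module.End.mul_apply, hf', hg', map_add,
      mul_sub, sub_mul]
    abel

variable {k A} in
theorem Cocycles1.leibniz (f : Cocycles1 k A) (x y : A) :
    f.1 (x * y) = x * f.1 y + f.1 x * y :=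
  (mem_ker_hochschildD1 f.1).1 f.2 x y

/-- Hochschild 1-coboundaries, an ideal of the Lie algebra of 1-cocycles. -/
def Coboundaries1 : LieIdeal k (Cocycles1 k A) where
  __ := (LinearMap.range (hochschildD0 k A)).comap (Cocycles1 k A).subtype
  lie_mem {f g} hg := by
    obtain ⟨m, hm⟩ := hg
    refine ⟨f.1 m, LinearMap.ext fun x => ?_⟩
    have hm' : ∀ x, g.1 x = x * m - m * x := fun x => by
      have := LinearMap.congr_fun hm x
      exact this.symm
    change x * f.1 m - f.1 m * x = f.1 (g.1 x) - g.1 (f.1 x)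
    rw [hm', hm', map_sub, Cocycles1.leibniz, Cocycles1.leibniz]
    abel

/-- The first Hochschild cohomology `HH¹(A) = Ker D₁ / Im D₀`, with the Lie algebra structure
given by the Gerstenhaber bracket. -/
def HH1 := Cocycles1 k A ⧸ Coboundaries1 k A

instance : LieRing (HH1 k A) := inferInstanceAs (LieRing (Cocycles1 k A ⧸ Coboundaries1 k A))

instance : LieAlgebra k (HH1 k A) :=
  inferInstanceAs (LieAlgebra k (Cocycles1 k A ⧸ Coboundaries1 k A))

variable {k A} in
/-- The class in `HH¹(A)` of a Hochschild 1-cocycle. -/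
def HH1.mk (f : Cocycles1 k A) : HH1 k A :=
  (LieSubmodule.Quotient.mk f : Cocycles1 k A ⧸ Coboundaries1 k A)

end Hochschild

/-! ## Toupie quivers and toupie algebras -/

/-- `V` is a toupie quiver with source `o` and sink `w`: `o` is the only vertex at which no arrow
ends, `w` is the only vertex at which no arrow starts, any other vertex is the source of exactly
one arrow and the target of exactly one arrow, and there are no oriented cycles (this excludes
isolated oriented cycles, which would be further connected components of the quiver). -/
structure IsToupie {V : Type*} [Quiver V] (o w : V) : Prop where
  source_iff : ∀ x : V, (∀ y : V, IsEmpty (y ⟶ x)) ↔ x = o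
  sink_iff : ∀ x : V, (∀ y : V, IsEmpty (x ⟶ y)) ↔ x = w
  existsUnique_out : ∀ x : V, x ≠ o → x ≠ w → ∃! α : Arrow V, α.1 = x
  existsUnique_in : ∀ x : V, x ≠ o → x ≠ w → ∃! α : Arrow V, α.2.1 = x
  acyclic : ∀ (x : V) (p : Quiver.Path x x), p.length = 0

section Toupie

variable {k : Type*} {V : Type*} [Quiver V] [CommRing k] [Fintype V]

/-- Admissible ideals: `J ^ N ⊆ I ⊆ J ^ 2` for some `N`, where `J` is the ideal generated by the
arrows (`J ^ n` is spanned by the paths of length at least `n`). -/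
structure IsAdmissible (I : Ideal (PathAlgebra k V)) : Prop where
  two_le_length : ∀ f ∈ I, ∀ p : QPath V, f.coeff p ≠ 0 → 2 ≤ p.2.2.length
  exists_length : ∃ N : ℕ, ∀ p : QPath V, N ≤ p.2.2.length → PathAlgebra.ofPath p ∈ I

variable (I : Ideal (PathAlgebra k V)) {o w : V}

/-- The branch `b` contains a monomial relation: some subpath of `b` belongs to `I`. -/
def ContainsMonomialRelation (b : Quiver.Path o w) : Prop :=
  ∃ (x y : V) (p : Quiver.Path o x) (q : Quiver.Path x y) (r : Quiver.Path y w),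
    b = (p.comp q).comp r ∧ PathAlgebra.ofPath ⟨x, y, q⟩ ∈ I

/-- The linear combination of branches (paths from `o` to `w`) with given coefficients. -/
def branchCombination (v : Quiver.Path o w →₀ k) : PathAlgebra k V :=
  v.sum fun b c => c • PathAlgebra.ofPath ⟨o, w, b⟩

/-- The branch `b` is the leading term of a linear combination of branches that lies in `I`; the
leading term is the first branch that occurs. The branches that are not leading terms are the
irreducible ones; their classes form the basis `₀𝓑_ω` of `e_o A e_w`. -/
def IsLeadingBranch [LinearOrder (Quiver.Path o w)] (b : Quiver.Path o w) : Prop :=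
  ∃ v : Quiver.Path o w →₀ k, branchCombination v ∈ I ∧ v b ≠ 0 ∧ ∀ c, c < b → v c = 0

/-- The rows of the reduced row echelon form of all linear relations between branches in `I`, for
the given order of the branches: the leading coefficient is `1`, and no other leading branch
occurs. -/
def IsReducedRelation [LinearOrder (Quiver.Path o w)] (v : Quiver.Path o w →₀ k) : Prop :=
  branchCombination v ∈ I ∧ ∃ b, IsLeadingBranch I b ∧ v b = 1 ∧
    ∀ c, IsLeadingBranch I c → c ≠ b → v c = 0

variable (o w)

/-- The vertices of `Q_ρ`: branches of length at least two without monomial relations. -/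
abbrev RhoVertex := {b : Quiver.Path o w // 2 ≤ b.length ∧ ¬ ContainsMonomialRelation I b}

/-- The graph `Q_ρ`: two different vertices are adjacent if some reduced relation involves both
branches. -/
def rhoGraph [LinearOrder (Quiver.Path o w)] : SimpleGraph (RhoVertex I o w) where
  Adj b c := b ≠ c ∧ ∃ v : Quiver.Path o w →₀ k, IsReducedRelation I v ∧ v b.1 ≠ 0 ∧ v c.1 ≠ 0
  symm := ⟨fun _ _ h => ⟨h.1.symm, h.2.imp fun _ hv => ⟨hv.1, hv.2.2, hv.2.1⟩⟩⟩
  loopless := ⟨fun _ h => h.1 rfl⟩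

/-- The irreducible branches of length at least two, i.e. `₀𝓑_ω - Z`. -/
abbrev LongIrreducible [LinearOrder (Quiver.Path o w)] :=
  {b : Quiver.Path o w // 2 ≤ b.length ∧ ¬ IsLeadingBranch I b}

/-- The branches that contain monomial relations. -/
abbrev MonomialBranch := {b : Quiver.Path o w // ContainsMonomialRelation I b}

end Toupie

/-! ## Cochains on arrows and their classes in `HH¹(A)` -/

section Cochains

variable {k : Type*} {V : Type*} [Quiver V] [CommRing k] [Fintype V]
variable (I : Ideal (PathAlgebra k V)) [I.IsTwoSided]

/-- The algebra `A = kQ/I`. -/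
def QuotAlgebra := PathAlgebra k V ⧸ I

instance : Ring (QuotAlgebra I) := inferInstanceAs (Ring (PathAlgebra k V ⧸ I))

instance : Algebra k (QuotAlgebra I) := inferInstanceAs (Algebra k (PathAlgebra k V ⧸ I))

/-- The class in `A = kQ/I` of a path. -/
def pathClass {x y : V} (p : Quiver.Path x y) : QuotAlgebra I :=
  Ideal.Quotient.mk I (PathAlgebra.ofPath ⟨x, y, p⟩)

/-- `f` is the extension to `A` of the 1-cochain `g` on arrows: the Hochschild 1-cocycle that
vanishes on the idempotents `e_x` and agrees with `g` on arrows. By the Leibniz rule it maps the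
class of a path `u` to `∑ u⁽¹⁾ g(u⁽²⁾) u⁽³⁾`, over all factorizations `u = u⁽¹⁾ u⁽²⁾ u⁽³⁾` whose
middle factor is an arrow, so it is unique. -/
def Extends (g : Arrow V → QuotAlgebra I) (f : Cocycles1 k (QuotAlgebra I)) : Prop :=
  (∀ x : V, f.1 (pathClass I (Quiver.Path.nil : Quiver.Path x x)) = 0) ∧
    ∀ α : Arrow V, f.1 (pathClass I α.2.2.toPath) = g α

/-- The 1-cochain `g` on arrows is a cocycle, i.e. represents a class in `HH¹(A)`. -/
def IsArrowCocycle (g : Arrow V → QuotAlgebra I) : Prop := ∃ f, Extends I g f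

open Classical in
/-- The class in `HH¹(A)` of a cocycle on arrows (and `0` if `g` is not a cocycle). -/
def arrowClass (g : Arrow V → QuotAlgebra I) : HH1 k (QuotAlgebra I) :=
  if h : IsArrowCocycle I g then HH1.mk h.choose else 0

open Classical in
/-- The cochain `α ‖ b`: it maps the arrow `α` to `b` and all other arrows to `0`. -/
def parallel (α : Arrow V) (b : QuotAlgebra I) : Arrow V → QuotAlgebra I :=
  fun β => if β = α then b else 0

/-- The first arrow of a path (none for a trivial path). -/
def firstArrow {x : V} : ∀ {y : V}, Quiver.Path x y → Option (Arrow V)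
  | _, .nil => none
  | _, .cons p e => (firstArrow p).orElse fun _ => some ⟨_, _, e⟩

/-- The cochain `α₀ ‖ α₀`, where `α₀` is the first arrow of the branch `b`. -/
def firstCochain {x y : V} (b : Quiver.Path x y) : Arrow V → QuotAlgebra I :=
  match firstArrow b with
  | some α => parallel I α (pathClass I α.2.2.toPath)
  | none => 0

variable {o w : V}

/-- `t_h`: the sum of the cochains `α₀ ‖ α₀`, over the branches in a component `h` of `Q_ρ`. -/
def tCochain [LinearOrder (Quiver.Path o w)] (h : (rhoGraph I o w).ConnectedComponent) :
    Arrow V → QuotAlgebra I :=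
  ∑ᶠ b : h.supp, firstCochain I b.1.1

/-- `z_{us} = α⁽ᵘ⁾ ‖ α⁽ˢ⁾`, for an arrow `α⁽ᵘ⁾` from `o` to `w` and a branch `α⁽ˢ⁾`. -/
def zCochain (u : o ⟶ w) (s : Quiver.Path o w) : Arrow V → QuotAlgebra I :=
  parallel I ⟨o, w, u⟩ (pathClass I s)

/-- The cochain `∑_{p,q} M_{qp} α⁽ᵖ⁾ ‖ α⁽ᑫ⁾` of a matrix `M`, where `α⁽¹⁾, …, α⁽ᵃ⁾` are the arrows
from `o` to `w`. -/
def matrixCochain {a : ℕ} (α : Fin a ≃ (o ⟶ w)) (M : Matrix (Fin a) (Fin a) k) :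
    Arrow V → QuotAlgebra I :=
  ∑ p, ∑ q, M q p • parallel I ⟨o, w, α p⟩ (pathClass I (α q).toPath)

end Cochains

end Toupie

end

/-! In a toupie quiver distinct parallel paths always run from `o` to `w`, and a branch is
determined by its first arrow. So `e_x A e_y` has dimension at most one unless `(x, y) = (o, w)`.
Modulo inner derivations a cocycle kills every `e_x` (`exists_relCocycles_mkHom_eq`) and hence
preserves each `e_x A e_y`. It multiplies every arrow not from `o` to `w` by a scalar, and sends the
arrows from `o` to `w` into `e_o A e_w`, the direct sum of their own span and that of the long
irreducible branches.

Such data extend to a cocycle exactly when the relations between branches are stable under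
multiplication of the coefficient of `b` by the sum `μ b` of the scalars along `b`
(`IsToupie.exists_extends`, `IsToupie.weight_smul_mem`). In terms of reduced row echelon form, `μ`
has to be constant on the support of each reduced relation, that is, on each component of `Q_ρ`. The
weight of a branch with a monomial relation is free, since no reduced relation involves it together
with another branch.

The inner derivations still available come from `∑ d_x e_x` and multiply an arrow from `x` to `y` by
`d_y - d_x`. They move the weight of each long branch to its first arrow. The remaining parameter
`d_w - d_o` adds a scalar matrix on the arrows from `o` to `w`, so the trace can be made zero in
exactly one way, because `a` is invertible. This gives existence (`IsToupie.exists_decomposition`)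
and uniqueness (`IsToupie.eq_zero_of_mkHom_eq_zero`) of `x = y + θ_M + t + z`.

For the brackets only the arrows from `o` to `w` matter, since scalars commute elsewhere. There `y`
and `t` vanish, `θ_M` permits a matrix product, and `z` takes values in long branches, which `z` and
`θ_M` kill and on which `t` is diagonal. Moreover `y` vanishes on all of `e_o A e_w`, so its class
is central. `exists_semidirect_decomposition` turns these bracket rules into the asserted
isomorphisms. -/

namespace Toupie

/-! ### Lie algebras assembled from a central, two abelian and one acting piece -/

section SemiDirect

open LieAlgebra

variable {k H G : Type*} [CommRing k] [LieRing H] [LieAlgebra k H] [LieRing G] [LieAlgebra k G]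

/-- An ideal is acted upon by derivations by any Lie algebra mapping to the ambient one. -/
def idealDerivation (J : LieIdeal k H) (f : G →ₗ⁅k⁆ H) : G →ₗ⁅k⁆ LieDerivation k J J where
  toFun x :=
    { toFun z := ⟨⁅f x, z.1⁆, J.lie_mem z.2⟩
      map_add' _ _ := Subtype.ext (lie_add _ _ _)
      map_smul' _ _ := Subtype.ext (lie_smul _ _ _)
      leibniz' y z := Subtype.ext (by
        change ⁅f x, ⁅y.1, z.1⁆⁆ = ⁅y.1, ⁅f x, z.1⁆⁆ - ⁅z.1, ⁅f x, y.1⁆⁆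
        rw [leibniz_lie, ← lie_skew z.1]
        abel) }
  map_add' x y := by
    ext z
    change ⁅f (x + y), z.1⁆ = ⁅f x, z.1⁆ + ⁅f y, z.1⁆
    rw [map_add, add_lie]
  map_smul' c x := by
    ext z
    change ⁅f (c • x), z.1⁆ = c • ⁅f x, z.1⁆
    rw [map_smul, smul_lie]
  map_lie' {x y} := by
    ext z
    change ⁅f ⁅x, y⁆, z.1⁆ = ⁅f x, ⁅f y, z.1⁆⁆ - ⁅f y, ⁅f x, z.1⁆⁆
    rw [LieHom.map_lie, lie_lie]

@[simp] theorem coe_idealDerivation (J : LieIdeal k H) (f : G →ₗ⁅k⁆ H) (x : G) (z : J) :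
    (idealDerivation J f x z : H) = ⁅f x, z.1⁆ := rfl

/-- A derivation of `K` that commutes with the action of `L` extends by `0` to `K ⋊ L`. -/
def semiDirectDerivation {K L : Type*} [LieRing K] [LieAlgebra k K] [LieRing L] [LieAlgebra k L]
    (θ : L →ₗ⁅k⁆ LieDerivation k K K) (δ : G →ₗ⁅k⁆ LieDerivation k K K)
    (h : ∀ g x z, δ g (θ x z) = θ x (δ g z)) :
    G →ₗ⁅k⁆ LieDerivation k (K ⋊⁅θ⁆ L) (K ⋊⁅θ⁆ L) where
  toFun g :=
    { toFun p := ⟨δ g p.left, 0⟩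
      map_add' _ _ := by simp
      map_smul' _ _ := by simp
      leibniz' p q := by
        change (⟨δ g (⁅p.left, q.left⁆ + θ p.right q.left - θ q.right p.left), 0⟩ : K ⋊⁅θ⁆ L) =
          ⟨⁅p.left, δ g q.left⁆ + θ p.right (δ g q.left) - θ 0 p.left, ⁅p.right, 0⁆⟩ -
            ⟨⁅q.left, δ g p.left⁆ + θ q.right (δ g p.left) - θ 0 q.left, ⁅q.right, 0⁆⟩
        simp only [SemiDirectSum.sub_eq_mk, map_add, map_sub, h, map_zero,
          LieDerivation.apply_lie_eq_sub, LieDerivation.coe_zero, Pi.zero_apply,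
          lie_zero, sub_zero, SemiDirectSum.mk.injEq, and_true]
        abel }
  map_add' _ _ := by ext p <;> simp
  map_smul' _ _ := by ext p <;> simp
  map_lie' {_ _} := by ext p <;> simp

/-- The pure Lie algebra content of the theorem. The direct sum decomposition and the bracket rules
determine every bracket of `H`, and the rules are those of the iterated semidirect sum: `C` is
central, and the image of `G` commutes with `S`, so that `G` acts on `Z` alone. -/
theorem exists_semidirect_decomposition (C S Z : Submodule k H) (Θ : G →ₗ⁅k⁆ H)
    (hC : ∀ y ∈ C, ∀ x : H, ⁅x, y⁆ = 0)
    (hS : ∀ t ∈ S, ∀ t' ∈ S, ⁅t, t'⁆ = 0) (hZ : ∀ z ∈ Z, ∀ z' ∈ Z, ⁅z, z'⁆ = 0)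
    (hSZ : ∀ t ∈ S, ∀ z ∈ Z, ⁅t, z⁆ ∈ Z) (hGZ : ∀ g, ∀ z ∈ Z, ⁅Θ g, z⁆ ∈ Z)
    (hGS : ∀ g, ∀ t ∈ S, ⁅Θ g, t⁆ = 0)
    (hinj : ∀ y ∈ C, ∀ g, ∀ t ∈ S, ∀ z ∈ Z, y + (Θ g + (t + z)) = 0 →
      y = 0 ∧ g = 0 ∧ t = 0 ∧ z = 0)
    (hsurj : ∀ x : H, ∃ y ∈ C, ∃ g, ∃ t ∈ S, ∃ z ∈ Z, x = y + (Θ g + (t + z))) :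
    ∃ (L : LieIdeal k H) (S₁ : LieSubalgebra k H) (L₂ C' : LieIdeal k H),
      L.toSubmodule = S ⊔ Z ∧ S₁.toSubmodule = S ∧ L₂.toSubmodule = Z ∧ C'.toSubmodule = C ∧
      IsSolvable L ∧ IsLieAbelian S₁ ∧ IsLieAbelian L₂ ∧ IsLieAbelian C' ∧
      ∃ θ : S₁ →ₗ⁅k⁆ LieDerivation k L₂ L₂,
        (∃ Ψ : (L₂ ⋊⁅θ⁆ S₁) ≃ₗ⁅k⁆ L, ∀ (z : L₂) (t : S₁), (Ψ ⟨z, t⟩ : H) = t.1 + z.1) ∧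
        ∃ ψ : G →ₗ⁅k⁆ LieDerivation k (L₂ ⋊⁅θ⁆ S₁) (L₂ ⋊⁅θ⁆ S₁),
          ∃ Φ : (C' × ((L₂ ⋊⁅θ⁆ S₁) ⋊⁅ψ⁆ G)) ≃ₗ⁅k⁆ H,
            ∀ (y : C') (z : L₂) (t : S₁) (g : G),
              Φ (y, ⟨⟨z, t⟩, g⟩) = y.1 + (Θ g + (t.1 + z.1)) := by
  have hC' : ∀ y ∈ C, ∀ x : H, ⁅y, x⁆ = 0 := fun y hy x => by rw [← lie_skew, hC y hy, neg_zero]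
  -- Expanding `x` along the decomposition leaves only brackets with one factor in `Z`. This one
  -- inclusion makes both `Z` and `S ⊔ Z` ideals, and puts the derived algebra of `S ⊔ Z` inside
  -- `Z`.
  have hideal : ∀ x : H, ∀ t ∈ S, ∀ z ∈ Z, ⁅x, t + z⁆ ∈ Z := by
    intro x t ht z hz
    obtain ⟨y, hy, g, t', ht', z', hz', rfl⟩ := hsurj x
    simp only [add_lie, lie_add, hC' y hy, hGS g t ht, hS t' ht' t ht, hZ z' hz' z hz, zero_add,
      add_zero]
    rw [← lie_skew z' t]
    exact add_mem (neg_mem (hSZ t ht z' hz')) (add_mem (hGZ g z hz) (hSZ t' ht' z hz))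
  let L₂ : LieIdeal k H :=
    { __ := Z
      lie_mem := fun {x z} hz => by simpa using hideal x 0 S.zero_mem z hz }
  let C' : LieIdeal k H :=
    { __ := C
      lie_mem := fun {x y} hy => by
        rw [hC y hy]
        exact C.zero_mem }
  let S₁ : LieSubalgebra k H :=
    { __ := S
      lie_mem' := fun {x y} hx hy => by
        rw [hS x hx y hy]
        exact S.zero_mem }
  let L : LieIdeal k H :=
    { __ := S ⊔ Z
      lie_mem := fun {x y} hy => by
        obtain ⟨t, ht, z, hz, rfl⟩ := Submodule.mem_sup.1 hy
        exact Submodule.mem_sup_right (hideal x t ht z hz) }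
  let θ : S₁ →ₗ⁅k⁆ LieDerivation k L₂ L₂ := idealDerivation L₂ S₁.incl
  have hθ : ∀ (t : S₁) (z : L₂), (θ t z : H) = ⁅t.1, z.1⁆ := fun _ _ => rfl
  have hS₁ : IsLieAbelian S₁ := ⟨fun x y => Subtype.ext (hS x.1 x.2 y.1 y.2)⟩
  have hL₂ : IsLieAbelian L₂ := ⟨fun x y => Subtype.ext (hZ x.1 x.2 y.1 y.2)⟩
  have hC₁ : IsLieAbelian C' := ⟨fun x y => Subtype.ext (hC' x.1 x.2 y.1)⟩
  let Ψ₀ : (L₂ ⋊⁅θ⁆ S₁) →ₗ⁅k⁆ L :=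
    { toFun p := ⟨p.right.1 + p.left.1, Submodule.add_mem_sup p.right.2 p.left.2⟩
      map_add' p q := Subtype.ext (by simp; abel)
      map_smul' c p := Subtype.ext (by simp)
      map_lie' {p q} := Subtype.ext (by
        obtain ⟨z, t⟩ := p
        obtain ⟨z', t'⟩ := q
        change ⁅t.1, t'.1⁆ + (⁅z.1, z'.1⁆ + ⁅t.1, z'.1⁆ - ⁅t'.1, z.1⁆) =
          ⁅t.1 + z.1, t'.1 + z'.1⁆
        rw [add_lie, lie_add, lie_add, ← lie_skew z.1 t'.1]
        abel) }
  have hΨ : Function.Bijective Ψ₀ := by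
    refine ⟨(injective_iff_map_eq_zero Ψ₀).2 fun ⟨z, t⟩ h => ?_, fun ⟨x, hx⟩ => ?_⟩
    · have h' : t.1 + z.1 = 0 := congrArg Subtype.val h
      obtain ⟨-, -, h₁, h₂⟩ := hinj 0 C.zero_mem 0 t.1 t.2 z.1 z.2 (by simpa using h')
      exact SemiDirectSum.ext (Subtype.ext h₂) (Subtype.ext h₁)
    · obtain ⟨t, ht, z, hz, rfl⟩ := Submodule.mem_sup.1 hx
      exact ⟨⟨⟨z, hz⟩, ⟨t, ht⟩⟩, rfl⟩
  have hsolv : IsSolvable L := by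
    have h₁ : derivedSeries k L 1 ≤ L₂.comap L.incl :=
      (LieSubmodule.lie_le_iff _ _ _).2 fun x _ y _ => by
        obtain ⟨t, ht, z, hz, h⟩ := Submodule.mem_sup.1 y.2
        change ⁅x.1, y.1⁆ ∈ Z
        rw [← h]
        exact hideal x.1 t ht z hz
    refine IsSolvable.mk (R := k) (k := 2) (eq_bot_iff.2 ((LieSubmodule.lie_le_iff _ _ _).2 ?_))
    exact fun x hx y hy => Subtype.ext (hZ _ (h₁ hx) _ (h₁ hy))
  let ψ : G →ₗ⁅k⁆ LieDerivation k (L₂ ⋊⁅θ⁆ S₁) (L₂ ⋊⁅θ⁆ S₁) :=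
    -- Jacobi identity: the two actions on `Z` commute because `⁅Θ g, t⁆ = 0`.
    semiDirectDerivation θ (idealDerivation L₂ Θ) fun g t z => Subtype.ext (by
      simp only [coe_idealDerivation, hθ]
      rw [leibniz_lie, hGS g t.1 t.2, zero_lie, zero_add])
  let Φ₀ : (C' × ((L₂ ⋊⁅θ⁆ S₁) ⋊⁅ψ⁆ G)) →ₗ⁅k⁆ H :=
    { toFun p := p.1.1 + (Θ p.2.right + (p.2.left.right.1 + p.2.left.left.1))
      map_add' p q := by simp; abel
      map_smul' c p := by simp
      map_lie' {p q} := by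
        obtain ⟨y, ⟨⟨z, t⟩, g⟩⟩ := p
        obtain ⟨y', ⟨⟨z', t'⟩, g'⟩⟩ := q
        change ⁅y.1, y'.1⁆ + (Θ ⁅g, g'⁆ + ((⁅t.1, t'.1⁆ + 0 - 0) +
          ((⁅z.1, z'.1⁆ + ⁅t.1, z'.1⁆ - ⁅t'.1, z.1⁆) + ⁅Θ g, z'.1⁆ - ⁅Θ g', z.1⁆))) =
          ⁅y.1 + (Θ g + (t.1 + z.1)), y'.1 + (Θ g' + (t'.1 + z'.1))⁆
        simp only [add_lie, lie_add, hC' _ y.2, hC _ y'.2, LieHom.map_lie, hGS _ _ t'.2]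
        rw [← lie_skew z.1 t'.1, ← lie_skew z.1 (Θ g'), ← lie_skew t.1 (Θ g'), hGS _ _ t.2]
        abel }
  have hΦ : Function.Bijective Φ₀ := by
    refine ⟨(injective_iff_map_eq_zero Φ₀).2 fun ⟨y, ⟨⟨z, t⟩, g⟩⟩ h => ?_, fun x => ?_⟩
    · obtain ⟨h₁, h₂, h₃, h₄⟩ := hinj y.1 y.2 g t.1 t.2 z.1 z.2 h
      exact Prod.ext (Subtype.ext h₁)
        (SemiDirectSum.ext (SemiDirectSum.ext (Subtype.ext h₄) (Subtype.ext h₃)) h₂)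
    · obtain ⟨y, hy, g, t, ht, z, hz, rfl⟩ := hsurj x
      exact ⟨⟨⟨y, hy⟩, ⟨⟨⟨z, hz⟩, ⟨t, ht⟩⟩, g⟩⟩, rfl⟩
  exact ⟨L, S₁, L₂, C', rfl, rfl, rfl, rfl, hsolv, hS₁, hL₂, hC₁, θ,
    ⟨LieEquiv.ofBijective Ψ₀ hΨ, fun _ _ => rfl⟩, ψ, LieEquiv.ofBijective Φ₀ hΦ,
    fun _ _ _ _ => rfl⟩

end SemiDirect

end Toupie

namespace Toupie

/-! ### Paths in a toupie quiver -/

section Paths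

open Quiver

variable {V : Type*} [Quiver V]

theorem firstArrow_toPath_comp {x y z : V} (e : x ⟶ y) (p : Path y z) :
    firstArrow (e.toPath.comp p) = some ⟨x, y, e⟩ := by
  induction p with
  | nil => rfl
  | cons p f ih => rw [Path.comp_cons, firstArrow, ih]; rfl

theorem exists_eq_toPath_comp {x y : V} (p : Path x y) (hp : 0 < p.length) :
    ∃ (z : V) (e : x ⟶ z) (r : Path z y), p = e.toPath.comp r :=
  have ⟨z, e, r, h, _⟩ := (Path.length_ne_zero_iff_eq_comp p).1 hp.ne'
  ⟨z, e, r, h⟩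

namespace IsToupie

variable {o w : V} (hQ : IsToupie o w)
include hQ

theorem target_ne_source {x y : V} (e : x ⟶ y) : y ≠ o := fun h =>
  ((hQ.source_iff y).2 h x).false e

theorem source_ne_sink {x y : V} (e : x ⟶ y) : x ≠ w := fun h =>
  ((hQ.sink_iff x).2 h y).false e

theorem target_ne_source_of_length_pos {x y : V} (p : Path x y) (hp : 0 < p.length) : y ≠ o := by
  cases p with
  | nil => simp at hp
  | cons p e => exact hQ.target_ne_source e

theorem eq_nil {x : V} (p : Path x x) : p = .nil :=
  Path.eq_nil_of_length_zero p (hQ.acyclic x p)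

/-- A path can be read backwards from its end: each vertex met on the way is not `w`, so it is `o`
or has a unique incoming arrow. -/
theorem subsingleton_path_of_ne_sink {x y : V} (hy : y ≠ w) : Subsingleton (Path x y) := by
  refine ⟨fun p q => ?_⟩
  induction p with
  | nil => exact (hQ.eq_nil q).symm
  | @cons b c p e ih =>
    cases q with
    | nil => exact hQ.eq_nil _
    | @cons b' _ q e' =>
      have h : (⟨b, c, e⟩ : Arrow V) = ⟨b', c, e'⟩ :=
        (hQ.existsUnique_in c (hQ.target_ne_source e) hy).unique rfl rfl
      cases h
      rw [ih (hQ.source_ne_sink e) q]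

/-- The forward version. Paths are built up at their last arrow, so peeling off the first one
requires induction on the length. -/
theorem subsingleton_path_of_ne_source {x y : V} (hx : x ≠ o) : Subsingleton (Path x y) := by
  refine ⟨fun p q => ?_⟩
  induction hn : p.length generalizing x with
  | zero =>
    obtain rfl := Path.eq_of_length_zero p hn
    rw [hQ.eq_nil p, hQ.eq_nil q]
  | succ n ih =>
    obtain ⟨z, e, r, hr, rfl⟩ := Path.eq_toPath_comp_of_length_eq_succ p hn
    obtain hq | hq := Nat.eq_zero_or_pos q.length
    · obtain rfl := Path.eq_of_length_zero q hq
      rw [hQ.eq_nil (e.toPath.comp r), hQ.eq_nil q]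
    · obtain ⟨z', e', r', rfl⟩ := exists_eq_toPath_comp q hq
      have h : (⟨x, z, e⟩ : Arrow V) = ⟨x, z', e'⟩ :=
        (hQ.existsUnique_out x hx (hQ.source_ne_sink e)).unique rfl rfl
      cases h
      rw [ih (hQ.target_ne_source e) r r' hr]

theorem subsingleton_path {x y : V} (h : ¬ (x = o ∧ y = w)) : Subsingleton (Path x y) := by
  by_cases hx : x = o
  · exact hQ.subsingleton_path_of_ne_sink fun hy => h ⟨hx, hy⟩
  · exact hQ.subsingleton_path_of_ne_source hx

/-- Any vertex is connected to the sink by a path. -/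
theorem nonempty_path_sink [Finite V] (x : V) : Nonempty (Path x w) := by
  -- Reversed reachability is well founded, as the quiver is finite and acyclic; the induction walks
  -- towards the sink.
  let r : V → V → Prop := fun y x => ∃ p : Path x y, 0 < p.length
  have : IsTrans V r := ⟨fun a b c ⟨p, hp⟩ ⟨q, hq⟩ => ⟨q.comp p, by simp [hp]⟩⟩
  have : Std.Irrefl r := ⟨fun a ⟨p, hp⟩ => hp.ne' (hQ.acyclic a p)⟩
  induction x using (Finite.wellFounded_of_trans_of_irrefl r).induction with
  | _ x ih =>
    by_cases hx : x = w
    · exact hx ▸ ⟨.nil⟩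
    · obtain ⟨y, hy⟩ := not_forall.1 (mt (hQ.sink_iff x).1 hx)
      obtain ⟨e⟩ := not_isEmpty_iff.1 hy
      obtain ⟨p⟩ := ih y ⟨e.toPath, by simp⟩
      exact ⟨e.toPath.comp p⟩

theorem branch_eq_of_first {y : V} (e : o ⟶ y) (p q : Path y w) :
    e.toPath.comp p = e.toPath.comp q := by
  rw [(hQ.subsingleton_path_of_ne_source (hQ.target_ne_source e)).elim p q]

theorem finite_branch [Finite V] [∀ x y : V, Finite (x ⟶ y)] (how : o ≠ w) :
    Finite (Path o w) := by
  have hpos : ∀ b : Path o w, 0 < b.length := fun b =>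
    Nat.pos_of_ne_zero fun h => how (Path.eq_of_length_zero b h)
  refine Finite.of_injective (β := Option (Arrow V)) firstArrow fun b c h => ?_
  obtain ⟨y, e, r, rfl⟩ := exists_eq_toPath_comp b (hpos b)
  obtain ⟨z, f, s, rfl⟩ := exists_eq_toPath_comp c (hpos c)
  rw [firstArrow_toPath_comp, firstArrow_toPath_comp] at h
  cases h
  exact hQ.branch_eq_of_first e r s

end IsToupie

/-- Paths that are not a single arrow from `o` to `w`, by induction on their last arrow; the arrows
of such a path are no arrows from `o` to `w` either. -/
theorem IsToupie.path_induction {o w : V} (hQ : IsToupie o w) {x : V}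
    {P : ∀ {y : V}, Path x y → Prop} (nil : P .nil)
    (cons : ∀ {y z : V} (p : Path x y) (e : y ⟶ z), ¬ (y = o ∧ z = w) → P p → P (p.cons e))
    {y : V} (p : Path x y) (hp : ¬ (x = o ∧ y = w ∧ p.length = 1)) : P p := by
  induction p with
  | nil => exact nil
  | @cons y z p e ih =>
    -- The truncated path cannot end at `w`. If the last arrow ran from `o` to `w`, the part before
    -- it would end at `o` and so be trivial, leaving just the excluded single arrow.
    refine cons p e ?_ (ih fun h => hQ.source_ne_sink e h.2.1)
    rintro ⟨rfl, rfl⟩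
    obtain h | h := Nat.eq_zero_or_pos p.length
    · exact hp ⟨Path.eq_of_length_zero p h, rfl, by simp [h]⟩
    · exact hQ.target_ne_source_of_length_pos p h rfl

end Paths

end Toupie

noncomputable section

namespace Toupie

open Quiver

/-! ### Classes in `HH¹` and inner derivations -/

section Hochschild

variable {k : Type*} [CommRing k] {A : Type*} [Ring A] [Algebra k A]

variable (k A) in
/-- The projection from 1-cocycles to `HH¹`. -/
def HH1.mkHom : Cocycles1 k A →ₗ⁅k⁆ HH1 k A where
  toFun := HH1.mk
  map_add' _ _ := rfl
  map_smul' _ _ := rfl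
  map_lie' := rfl

theorem HH1.mkHom_surjective : Function.Surjective (HH1.mkHom k A) :=
  LieSubmodule.Quotient.surjective_mk' (Coboundaries1 k A)

theorem HH1.mkHom_eq_zero {f : Cocycles1 k A} : HH1.mkHom k A f = 0 ↔ f ∈ Coboundaries1 k A :=
  LieSubmodule.Quotient.mk_eq_zero _

theorem mem_coboundaries1 {f : Cocycles1 k A} :
    f ∈ Coboundaries1 k A ↔ ∃ m, ∀ a, f.1 a = a * m - m * a :=
  exists_congr fun _ => ⟨fun h a => (LinearMap.congr_fun h a).symm,
    fun h => LinearMap.ext fun a => (h a).symm⟩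

variable (k) in
/-- The inner derivation given by an element of the algebra. -/
def innerCocycle (m : A) : Cocycles1 k A :=
  ⟨hochschildD0 k A m, (mem_ker_hochschildD1 _).2 fun x y => by
    change x * y * m - m * (x * y) = x * (y * m - m * y) + (x * m - m * x) * y
    noncomm_ring⟩

theorem innerCocycle_apply (m a : A) : (innerCocycle k m).1 a = a * m - m * a := rfl

theorem innerCocycle_mem (m : A) : innerCocycle k m ∈ Coboundaries1 k A :=
  mem_coboundaries1.2 ⟨m, fun _ => rfl⟩

end Hochschild

/-! ### The algebra `A`, its corners `e_x A e_y`, and derivations from the path algebra -/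

section Quotient

variable {k : Type*} {V : Type*} [Quiver V] [CommRing k] [Fintype V]
variable (I : Ideal (PathAlgebra k V)) [I.IsTwoSided]

/-- The projection from the path algebra to its quotient. -/
def quotMk : PathAlgebra k V →ₐ[k] QuotAlgebra I := Ideal.Quotient.mkₐ k I

theorem quotMk_surjective : Function.Surjective (quotMk I) := Ideal.Quotient.mk_surjective

variable {I} in
theorem quotMk_eq_zero {f : PathAlgebra k V} : quotMk I f = 0 ↔ f ∈ I :=
  Ideal.Quotient.eq_zero_iff_mem

theorem quotMk_ofPath {x y : V} (p : Path x y) :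
    quotMk I (PathAlgebra.ofPath ⟨x, y, p⟩) = pathClass I p := rfl

theorem PathAlgebra.ofPath_mul {x y z : V} (p : Path x y) (q : Path y z) :
    (PathAlgebra.ofPath ⟨x, y, p⟩ * PathAlgebra.ofPath ⟨y, z, q⟩ : PathAlgebra k V) =
      PathAlgebra.ofPath ⟨x, z, p.comp q⟩ := by
  rw [PathAlgebra.mul_def, PathAlgebra.mulLin_ofPath]
  simp [PathAlgebra.mulPath]

theorem PathAlgebra.ofPath_mul_of_ne {x y z t : V} (p : Path x y) (q : Path z t) (h : z ≠ y) :
    (PathAlgebra.ofPath ⟨x, y, p⟩ * PathAlgebra.ofPath ⟨z, t, q⟩ : PathAlgebra k V) = 0 := by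
  rw [PathAlgebra.mul_def, PathAlgebra.mulLin_ofPath]
  simp [PathAlgebra.mulPath, h]

theorem pathClass_mul {x y z : V} (p : Path x y) (q : Path y z) :
    pathClass I p * pathClass I q = pathClass I (p.comp q) := by
  rw [← quotMk_ofPath, ← quotMk_ofPath, ← map_mul, PathAlgebra.ofPath_mul, quotMk_ofPath]

theorem pathClass_mul_of_ne {x y z t : V} (p : Path x y) (q : Path z t) (h : z ≠ y) :
    pathClass I p * pathClass I q = 0 := by
  rw [← quotMk_ofPath, ← quotMk_ofPath, ← map_mul, PathAlgebra.ofPath_mul_of_ne _ _ h, map_zero]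

/-- The class in `A` of the idempotent of a vertex. -/
abbrev idem (x : V) : QuotAlgebra I := pathClass I (.nil : Path x x)

theorem sum_idem : ∑ x, idem I x = 1 := by
  rw [← map_one (quotMk I), PathAlgebra.one_def, map_sum]
  rfl

theorem linearMap_ext_pathClass {M : Type*} [AddCommGroup M] [Module k M]
    {f g : QuotAlgebra I →ₗ[k] M}
    (h : ∀ (x y : V) (p : Path x y), f (pathClass I p) = g (pathClass I p)) : f = g := by
  ext a
  obtain ⟨a, rfl⟩ := quotMk_surjective I a
  induction a using PathAlgebra.induction_path with
  | h0 => simp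
  | hadd a b ha hb => simp only [map_add, ha, hb]
  | hs c p =>
    obtain ⟨x, y, p⟩ := p
    simp only [map_smul, quotMk_ofPath, h]

/-- The space `e_x A e_y`, spanned by the classes of the paths from `x` to `y`. -/
def corner (x y : V) : Submodule k (QuotAlgebra I) :=
  Submodule.span k (Set.range fun p : Path x y => pathClass I p)

variable {I}

theorem pathClass_mem_corner {x y : V} (p : Path x y) : pathClass I p ∈ corner I x y :=
  Submodule.subset_span ⟨p, rfl⟩

theorem corner_induction {x y : V} {P : QuotAlgebra I → Prop} (zero : P 0)
    (add : ∀ a b, P a → P b → P (a + b)) (smul : ∀ (c : k) (a), P a → P (c • a))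
    (path : ∀ p : Path x y, P (pathClass I p)) {a : QuotAlgebra I} (ha : a ∈ corner I x y) :
    P a := by
  induction ha using Submodule.span_induction with
  | zero => exact zero
  | mem _ h =>
    obtain ⟨p, rfl⟩ := h
    exact path p
  | add _ _ _ _ h h' => exact add _ _ h h'
  | smul c _ _ h => exact smul c _ h

theorem mul_mem_corner {x y z : V} {a b : QuotAlgebra I} (ha : a ∈ corner I x y)
    (hb : b ∈ corner I y z) : a * b ∈ corner I x z := by
  refine corner_induction (P := fun a => a * b ∈ corner I x z) (by simp)
    (fun _ _ h h' => by rw [add_mul]; exact add_mem h h')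
    (fun c _ h => by rw [smul_mul_assoc]; exact Submodule.smul_mem _ c h) (fun p => ?_) ha
  refine corner_induction (P := fun b => pathClass I p * b ∈ corner I x z) (by simp)
    (fun _ _ h h' => by rw [mul_add]; exact add_mem h h')
    (fun c _ h => by rw [mul_smul_comm]; exact Submodule.smul_mem _ c h) (fun q => ?_) hb
  rw [pathClass_mul]
  exact pathClass_mem_corner _

theorem mul_eq_zero_of_mem_corner {x y z t : V} (h : z ≠ y) {a b : QuotAlgebra I}
    (ha : a ∈ corner I x y) (hb : b ∈ corner I z t) : a * b = 0 := by
  refine corner_induction (P := fun a => a * b = 0) (by simp)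
    (fun _ _ h h' => by rw [add_mul, h, h', add_zero])
    (fun c _ h => by rw [smul_mul_assoc, h, smul_zero]) (fun p => ?_) ha
  refine corner_induction (P := fun b => pathClass I p * b = 0) (by simp)
    (fun _ _ h h' => by rw [mul_add, h, h', add_zero])
    (fun c _ h => by rw [mul_smul_comm, h, smul_zero]) (fun q => ?_) hb
  exact pathClass_mul_of_ne I p q h

theorem idem_mul_mul_idem_mem_corner (x y : V) (a : QuotAlgebra I) :
    idem I x * a * idem I y ∈ corner I x y := by
  obtain ⟨a, rfl⟩ := quotMk_surjective I a
  induction a using PathAlgebra.induction_path with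
  | h0 => simp
  | hadd a b ha hb => simpa only [map_add, mul_add, add_mul] using add_mem ha hb
  | hs c p =>
    obtain ⟨x', y', p⟩ := p
    rw [map_smul, quotMk_ofPath, mul_smul_comm, smul_mul_assoc]
    refine Submodule.smul_mem _ c ?_
    by_cases hx : x' = x
    · subst hx
      rw [pathClass_mul, Path.nil_comp]
      by_cases hy : y = y'
      · subst hy
        rw [pathClass_mul]
        exact pathClass_mem_corner _
      · rw [pathClass_mul_of_ne I _ _ hy]
        exact zero_mem _
    · rw [pathClass_mul_of_ne I _ _ hx, zero_mul]
      exact zero_mem _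

theorem exists_smul_of_mem_corner {x y : V} [Subsingleton (Path x y)] (p : Path x y)
    {a : QuotAlgebra I} (ha : a ∈ corner I x y) : ∃ c : k, a = c • pathClass I p := by
  refine corner_induction (P := fun a => ∃ c : k, a = c • pathClass I p) ⟨0, by simp⟩ ?_ ?_
    (fun q => ⟨1, by rw [Subsingleton.elim q p, one_smul]⟩) ha
  · rintro _ _ ⟨c, rfl⟩ ⟨d, rfl⟩
    exact ⟨c + d, (add_smul c d _).symm⟩
  · rintro c _ ⟨d, rfl⟩
    exact ⟨c * d, (mul_smul c d _).symm⟩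

/-! ### Extension of cochains on arrows -/

/-- The value on a path of the derivation with given values on arrows. -/
def pathDer (g : Arrow V → QuotAlgebra I) {x : V} : ∀ {y : V}, Path x y → QuotAlgebra I
  | _, .nil => 0
  | _, .cons p e => pathClass I p * g ⟨_, _, e⟩ + pathDer g p * pathClass I e.toPath

theorem pathDer_toPath (g : Arrow V → QuotAlgebra I) {x y : V} (e : x ⟶ y)
    (hg : g ⟨x, y, e⟩ ∈ corner I x y) : pathDer g e.toPath = g ⟨x, y, e⟩ := by
  change idem I x * g ⟨x, y, e⟩ + 0 * _ = _
  rw [zero_mul, add_zero]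
  refine corner_induction (P := fun a => idem I x * a = a) (by simp)
    (fun _ _ h h' => by rw [mul_add, h, h']) (fun c _ h => by rw [mul_smul_comm, h])
    (fun p => by rw [pathClass_mul, Path.nil_comp]) hg

theorem pathDer_mem_corner {g : Arrow V → QuotAlgebra I} (hg : ∀ e, g e ∈ corner I e.1 e.2.1)
    {x y : V} (p : Path x y) : pathDer g p ∈ corner I x y := by
  induction p with
  | nil => exact zero_mem _
  | cons p e ih =>
    exact add_mem (mul_mem_corner (pathClass_mem_corner p) (hg ⟨_, _, e⟩))
      (mul_mem_corner ih (pathClass_mem_corner _))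

/-- Leibniz rule on paths. The corner condition enters for a trivial `q`, where multiplication by
`e_y` must fix `pathDer g p`. -/
theorem pathDer_comp {g : Arrow V → QuotAlgebra I} (hg : ∀ e, g e ∈ corner I e.1 e.2.1)
    {x y z : V} (p : Path x y) (q : Path y z) :
    pathDer g (p.comp q) = pathClass I p * pathDer g q + pathDer g p * pathClass I q := by
  induction q with
  | nil =>
    rw [Path.comp_nil, pathDer, mul_zero, zero_add]
    refine (corner_induction (P := fun a => a * idem I y = a) (by simp)
      (fun _ _ h h' => by rw [add_mul, h, h']) (fun c _ h => by rw [smul_mul_assoc, h])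
      (fun p => by rw [pathClass_mul, Path.comp_nil]) (pathDer_mem_corner hg p)).symm
  | cons q e ih =>
    rw [Path.comp_cons, pathDer, pathDer, ih, ← pathClass_mul, add_mul, mul_add, mul_assoc,
      mul_assoc, mul_assoc, pathClass_mul I q, Path.comp_toPath_eq_cons, add_assoc]

/-- The derivation `kQ → A` with given values on arrows. -/
def freeDer (g : Arrow V → QuotAlgebra I) : PathAlgebra k V →ₗ[k] QuotAlgebra I :=
  Finsupp.linearCombination k fun p : QPath V => pathDer g p.2.2

theorem freeDer_ofPath (g : Arrow V → QuotAlgebra I) {x y : V} (p : Path x y) :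
    freeDer g (.ofPath ⟨x, y, p⟩) = pathDer g p := by
  unfold freeDer PathAlgebra.ofPath
  erw [Finsupp.linearCombination_single, one_smul]

theorem freeDer_mul {g : Arrow V → QuotAlgebra I} (hg : ∀ e, g e ∈ corner I e.1 e.2.1)
    (a b : PathAlgebra k V) :
    freeDer g (a * b) = quotMk I a * freeDer g b + freeDer g a * quotMk I b := by
  induction a using PathAlgebra.induction_path with
  | h0 => simp
  | hadd a a' ha ha' => simp only [add_mul, map_add, ha, ha']; abel
  | hs c p =>
  induction b using PathAlgebra.induction_path with
  | h0 => simp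
  | hadd b b' hb hb' => simp only [mul_add, map_add, hb, hb']; abel
  | hs d q =>
  simp only [smul_mul_smul_comm, map_smul, ← smul_add]
  congr 1
  obtain ⟨x, y, p⟩ := p
  obtain ⟨z, t, q⟩ := q
  rw [freeDer_ofPath, freeDer_ofPath, quotMk_ofPath, quotMk_ofPath]
  by_cases h : z = y
  · subst h
    rw [PathAlgebra.ofPath_mul, freeDer_ofPath, pathDer_comp hg]
  · rw [PathAlgebra.ofPath_mul_of_ne _ _ h,
      mul_eq_zero_of_mem_corner h (pathClass_mem_corner p) (pathDer_mem_corner hg q),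
      mul_eq_zero_of_mem_corner h (pathDer_mem_corner hg p) (pathClass_mem_corner q),
      map_zero, add_zero]

theorem branchCombination_eq {x y : V} (v : Path x y →₀ k) :
    branchCombination v =
      Finsupp.linearCombination k (fun p => PathAlgebra.ofPath (k := k) ⟨x, y, p⟩) v := rfl

theorem exists_branchCombination (x y : V) (a : PathAlgebra k V) :
    ∃ v : Path x y →₀ k,
      PathAlgebra.vertex x * a * PathAlgebra.vertex y = branchCombination v := by
  simp only [branchCombination_eq]
  induction a using PathAlgebra.induction_path with
  | h0 => exact ⟨0, by simp⟩
  | hadd a b ha hb =>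
    obtain ⟨v, hv⟩ := ha
    obtain ⟨v', hv'⟩ := hb
    exact ⟨v + v', by rw [map_add, mul_add, add_mul, hv, hv']⟩
  | hs c p =>
    obtain ⟨x', y', p⟩ := p
    rw [mul_smul_comm, smul_mul_assoc, PathAlgebra.vertex, PathAlgebra.vertex]
    by_cases hx : x' = x
    · subst hx
      rw [PathAlgebra.ofPath_mul, Path.nil_comp]
      by_cases hy : y = y'
      · subst hy
        rw [PathAlgebra.ofPath_mul, Path.comp_nil]
        exact ⟨Finsupp.single p c, by rw [Finsupp.linearCombination_single]⟩
      · rw [PathAlgebra.ofPath_mul_of_ne _ _ hy]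
        exact ⟨0, by simp⟩
    · rw [PathAlgebra.ofPath_mul_of_ne _ _ hx, zero_mul]
      exact ⟨0, by simp⟩

/-- A linear map that vanishes on the homogeneous elements of an ideal vanishes on the ideal. -/
theorem eq_zero_of_mem_ideal {M : Type*} [AddCommGroup M] [Module k M] (D : PathAlgebra k V →ₗ[k] M)
    (h : ∀ (x y : V) (v : Path x y →₀ k), branchCombination v ∈ I → D (branchCombination v) = 0)
    {a : PathAlgebra k V} (ha : a ∈ I) : D a = 0 := by
  have : a = ∑ x, ∑ y, PathAlgebra.vertex x * a * PathAlgebra.vertex y := by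
    simp_rw [← Finset.mul_sum, ← Finset.sum_mul, ← PathAlgebra.one_def, one_mul, mul_one]
  rw [this, map_sum]
  refine Finset.sum_eq_zero fun x _ => ?_
  rw [map_sum]
  refine Finset.sum_eq_zero fun y _ => ?_
  have hm := I.mul_mem_right (PathAlgebra.vertex y) (I.mul_mem_left (PathAlgebra.vertex x) ha)
  obtain ⟨v, hv⟩ := exists_branchCombination x y a
  rw [hv] at hm ⊢
  exact h x y v hm

end Quotient

section Field

variable {k : Type*} {V : Type*} [Quiver V] [Field k] [Fintype V]
variable {I : Ideal (PathAlgebra k V)} [I.IsTwoSided]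

theorem exists_cocycle_of_freeDer {g : Arrow V → QuotAlgebra I}
    (hg : ∀ e, g e ∈ corner I e.1 e.2.1) (h : ∀ a ∈ I, freeDer g a = 0) :
    ∃ f : Cocycles1 k (QuotAlgebra I), Extends I g f := by
  -- A linear section of the projection to `A`; since `freeDer g` kills `I`, composing it with `s`
  -- gives the induced map on `A`.
  obtain ⟨s, hs⟩ := LinearMap.exists_rightInverse_of_surjective (quotMk I).toLinearMap
    (LinearMap.range_eq_top.2 (quotMk_surjective I))
  have hs' : ∀ a, quotMk I (s a) = a := fun a => LinearMap.congr_fun hs a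
  have key : ∀ a, freeDer g (s (quotMk I a)) = freeDer g a := fun a => by
    refine sub_eq_zero.1 ?_
    rw [← map_sub]
    exact h _ (quotMk_eq_zero.1 (by rw [map_sub, hs', sub_self]))
  refine ⟨⟨freeDer g ∘ₗ s, (mem_ker_hochschildD1 _).2 fun a b => ?_⟩, fun x => ?_, fun e => ?_⟩
  · obtain ⟨a, rfl⟩ := quotMk_surjective I a
    obtain ⟨b, rfl⟩ := quotMk_surjective I b
    simp only [LinearMap.comp_apply, ← map_mul, key, freeDer_mul hg]
  · change freeDer g (s (quotMk I _)) = 0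
    rw [key, freeDer_ofPath, pathDer]
  · change freeDer g (s (quotMk I _)) = g e
    rw [key, freeDer_ofPath, pathDer_toPath _ _ (hg e)]

end Field

end Toupie

end

noncomputable section

namespace Toupie

open Quiver

/-! ### Cocycles that vanish on the vertex idempotents -/

section RelCocycles

variable {k : Type*} {V : Type*} [Quiver V] [CommRing k] [Fintype V]
variable {I : Ideal (PathAlgebra k V)} [I.IsTwoSided]

theorem idem_mul_pathClass {x y : V} (p : Path x y) : idem I x * pathClass I p = pathClass I p := by
  rw [pathClass_mul, Path.nil_comp]

theorem pathClass_mul_idem {x y : V} (p : Path x y) : pathClass I p * idem I y = pathClass I p := by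
  rw [pathClass_mul, Path.comp_nil]

variable (I) in
/-- The 1-cocycles that vanish on the idempotents of the vertices. -/
def relCocycles : LieSubalgebra k (Cocycles1 k (QuotAlgebra I)) where
  carrier := {f | ∀ x, f.1 (idem I x) = 0}
  add_mem' {f g} hf hg x := by
    change f.1 _ + g.1 _ = 0
    rw [hf x, hg x, add_zero]
  zero_mem' _ := rfl
  smul_mem' c f hf x := by
    change c • f.1 _ = 0
    rw [hf x, smul_zero]
  lie_mem' {f g} hf hg x := by
    change f.1 (g.1 _) - g.1 (f.1 _) = 0
    rw [hf x, hg x, map_zero, map_zero, sub_zero]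

theorem relCocycles_apply_pathClass {f : Cocycles1 k (QuotAlgebra I)} (hf : f ∈ relCocycles I)
    {x y : V} (p : Path x y) :
    f.1 (pathClass I p) = pathDer (fun e => f.1 (pathClass I e.2.2.toPath)) p := by
  induction p with
  | nil => exact hf x
  | cons p e ih =>
    rw [← Path.comp_toPath_eq_cons, ← pathClass_mul, Cocycles1.leibniz, ih]
    rfl

theorem relCocycles_ext {f g : Cocycles1 k (QuotAlgebra I)} (hf : f ∈ relCocycles I)
    (hg : g ∈ relCocycles I)
    (h : ∀ e : Arrow V, f.1 (pathClass I e.2.2.toPath) = g.1 (pathClass I e.2.2.toPath)) :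
    f = g := by
  refine Subtype.ext (linearMap_ext_pathClass I fun x y p => ?_)
  rw [relCocycles_apply_pathClass hf, relCocycles_apply_pathClass hg, funext h]

/-- A derivation that kills `e_x` and `e_y` satisfies `f (e_x a e_y) = e_x f(a) e_y`. -/
theorem relCocycles_map_mem_corner {f : Cocycles1 k (QuotAlgebra I)} (hf : f ∈ relCocycles I)
    {x y : V} {a : QuotAlgebra I} (ha : a ∈ corner I x y) : f.1 a ∈ corner I x y := by
  refine corner_induction (P := fun a => f.1 a ∈ corner I x y) (by simp)
    (fun _ _ h h' => by rw [map_add]; exact add_mem h h')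
    (fun c _ h => by rw [map_smul]; exact Submodule.smul_mem _ c h) (fun p => ?_) ha
  have h : pathClass I p = idem I x * pathClass I p * idem I y := by
    rw [idem_mul_pathClass, pathClass_mul_idem]
  rw [h, Cocycles1.leibniz, Cocycles1.leibniz, hf x, hf y, mul_zero, zero_mul, zero_add, add_zero]
  exact idem_mul_mul_idem_mem_corner x y _

theorem Extends.unique {g : Arrow V → QuotAlgebra I} {f f' : Cocycles1 k (QuotAlgebra I)}
    (h : Extends I g f) (h' : Extends I g f') : f = f' :=
  relCocycles_ext h.1 h'.1 fun e => (h.2 e).trans (h'.2 e).symm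

theorem arrowClass_eq {g : Arrow V → QuotAlgebra I} {f : Cocycles1 k (QuotAlgebra I)}
    (h : Extends I g f) : arrowClass I g = HH1.mkHom k _ f := by
  have h' : IsArrowCocycle I g := ⟨f, h⟩
  rw [arrowClass, dif_pos h', h'.choose_spec.unique h]
  rfl

/-- Every class in `HH¹` has a representative that vanishes on the idempotents of the vertices. -/
theorem exists_relCocycles_mkHom_eq (x : HH1 k (QuotAlgebra I)) :
    ∃ f ∈ relCocycles I, HH1.mkHom k _ f = x := by
  obtain ⟨D, rfl⟩ := HH1.mkHom_surjective x
  -- Differentiating `e_x e_y` shows that `e_y m - m e_y = D(e_y)`, so the inner derivation of `m`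
  -- agrees with `D` on the idempotents.
  let m : QuotAlgebra I := ∑ x, idem I x * D.1 (idem I x)
  have hidem : ∀ x, idem I x * idem I x = idem I x := fun x => idem_mul_pathClass _
  have hne : ∀ x y, y ≠ x → idem I x * idem I y = 0 := fun x y h => pathClass_mul_of_ne I _ _ h
  have hl : ∀ y, idem I y * m = idem I y * D.1 (idem I y) := fun y => by
    rw [Finset.mul_sum, Finset.sum_eq_single y, ← mul_assoc, hidem]
    · intro x _ hx
      rw [← mul_assoc, hne y x hx, zero_mul]
    · simp
  have hr : ∀ y, m * idem I y = idem I y * D.1 (idem I y) - D.1 (idem I y) := fun y => by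
    have h : ∀ x, idem I x * D.1 (idem I x) * idem I y =
        idem I x * D.1 (idem I x * idem I y) - idem I x * D.1 (idem I y) := fun x => by
      rw [Cocycles1.leibniz, mul_add, ← mul_assoc, ← mul_assoc, hidem]
      abel
    rw [Finset.sum_mul, Finset.sum_congr rfl fun x _ => h x, Finset.sum_sub_distrib,
      ← Finset.sum_mul, sum_idem, one_mul, Finset.sum_eq_single y, hidem]
    · intro x _ hx
      rw [hne x y hx.symm, map_zero, mul_zero]
    · simp
  refine ⟨D - innerCocycle k m, fun y => ?_, ?_⟩
  · change D.1 (idem I y) - (idem I y * m - m * idem I y) = 0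
    rw [hl, hr]
    abel
  · rw [map_sub, HH1.mkHom_eq_zero.2 (innerCocycle_mem m), sub_zero]

/-- The inner derivations that vanish on the idempotents of the vertices. -/
theorem exists_inner_relCocycle (d : V → k) :
    ∃ f ∈ relCocycles I, HH1.mkHom k _ f = 0 ∧ ∀ {x y : V} (e : x ⟶ y),
      f.1 (pathClass I e.toPath) = (d y - d x) • pathClass I e.toPath := by
  let m : QuotAlgebra I := ∑ x, d x • idem I x
  have h : ∀ {x y : V} (p : Path x y),
      (innerCocycle k m).1 (pathClass I p) = (d y - d x) • pathClass I p := fun {x y} p => by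
    rw [innerCocycle_apply, Finset.mul_sum, Finset.sum_mul, Finset.sum_eq_single y,
      Finset.sum_eq_single x, mul_smul_comm, smul_mul_assoc, pathClass_mul_idem,
      idem_mul_pathClass, sub_smul]
    · intro z _ hz
      rw [smul_mul_assoc, pathClass_mul_of_ne I _ _ hz.symm, smul_zero]
    · simp
    · intro z _ hz
      rw [mul_smul_comm, pathClass_mul_of_ne I _ _ hz, smul_zero]
    · simp
  exact ⟨innerCocycle k m, fun x => by rw [h, sub_self, zero_smul],
    HH1.mkHom_eq_zero.2 (innerCocycle_mem m), fun e => h _⟩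

/-- If the derivation is given by `m` and kills the idempotents, then `m` commutes with them. As
there are no oriented cycles, `e_x A e_x` is spanned by `e_x`, so `m` acts at each vertex as a
scalar. -/
theorem IsToupie.exists_of_mkHom_eq_zero {o w : V} (hQ : IsToupie o w)
    {f : Cocycles1 k (QuotAlgebra I)} (hf : f ∈ relCocycles I) (h : HH1.mkHom k _ f = 0) :
    ∃ d : V → k, ∀ {x y : V} (e : x ⟶ y),
      f.1 (pathClass I e.toPath) = (d y - d x) • pathClass I e.toPath := by
  obtain ⟨m, hm⟩ := mem_coboundaries1.1 (HH1.mkHom_eq_zero.1 h)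
  have hcomm : ∀ x, idem I x * m = m * idem I x := fun x => sub_eq_zero.1 ((hm _).symm.trans (hf x))
  have hd : ∀ x, ∃ c : k, idem I x * m = c • idem I x := fun x => by
    have : Subsingleton (Path x x) := ⟨fun p q => by rw [hQ.eq_nil p, hQ.eq_nil q]⟩
    have hx : idem I x * m = idem I x * m * idem I x := by
      rw [mul_assoc, ← hcomm, ← mul_assoc, idem_mul_pathClass]
    rw [hx]
    exact exists_smul_of_mem_corner .nil (idem_mul_mul_idem_mem_corner x x m)
  choose d hd using hd
  refine ⟨d, fun {x y} e => ?_⟩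
  rw [hm, sub_smul]
  congr 1
  · rw [← pathClass_mul_idem, mul_assoc, hd, mul_smul_comm, pathClass_mul_idem]
  · rw [← idem_mul_pathClass, ← mul_assoc, ← hcomm, hd, smul_mul_assoc, idem_mul_pathClass]

end RelCocycles

/-! ### Weights of paths and relations between branches -/

section Weight

variable {k : Type*} {V : Type*} [Quiver V] [CommRing k]

/-- The sum of the weights of the arrows of a path. -/
def pathWeight (c : Arrow V → k) {x : V} : ∀ {y : V}, Path x y → k
  | _, .nil => 0
  | _, .cons p e => pathWeight c p + c ⟨_, _, e⟩

theorem pathWeight_comp (c : Arrow V → k) {x y z : V} (p : Path x y) (q : Path y z) :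
    pathWeight c (p.comp q) = pathWeight c p + pathWeight c q := by
  induction q with
  | nil => simp [pathWeight]
  | cons q e ih => rw [Path.comp_cons, pathWeight, pathWeight, ih, add_assoc]

theorem pathWeight_toPath (c : Arrow V → k) {x y : V} (e : x ⟶ y) :
    pathWeight c e.toPath = c ⟨x, y, e⟩ := zero_add _

variable [Fintype V] {I : Ideal (PathAlgebra k V)} [I.IsTwoSided] {o w : V}

/-- Apart from a single arrow from `o` to `w`, a path only uses arrows on which `g` is scalar, and
by the Leibniz rule these scalars add up. -/
theorem IsToupie.pathDer_eq_weight (hQ : IsToupie o w) {g : Arrow V → QuotAlgebra I}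
    {c : Arrow V → k}
    (hc : ∀ e : Arrow V, ¬ (e.1 = o ∧ e.2.1 = w) → g e = c e • pathClass I e.2.2.toPath)
    {x y : V} (p : Path x y) (hp : ¬ (x = o ∧ y = w ∧ p.length = 1)) :
    pathDer g p = pathWeight c p • pathClass I p := by
  refine hQ.path_induction (P := fun p => pathDer g p = pathWeight c p • pathClass I p)
    (zero_smul _ _).symm (fun p e he ih => ?_) p hp
  rw [pathDer, pathWeight, ih, hc ⟨_, _, e⟩ he, mul_smul_comm, smul_mul_assoc, pathClass_mul,
    Path.comp_toPath_eq_cons, ← add_smul, add_comm]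

theorem IsToupie.relCocycles_apply_eq_weight (hQ : IsToupie o w)
    {f : Cocycles1 k (QuotAlgebra I)} (hf : f ∈ relCocycles I) {c : Arrow V → k}
    (hc : ∀ e : Arrow V, ¬ (e.1 = o ∧ e.2.1 = w) →
      f.1 (pathClass I e.2.2.toPath) = c e • pathClass I e.2.2.toPath)
    {x y : V} (p : Path x y) (hp : ¬ (x = o ∧ y = w ∧ p.length = 1)) :
    f.1 (pathClass I p) = pathWeight c p • pathClass I p := by
  rw [relCocycles_apply_pathClass hf, hQ.pathDer_eq_weight hc p hp]

/-- Cocycles act by scalars on the arrows that do not join the source to the sink. -/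
theorem IsToupie.exists_arrow_scalars (hQ : IsToupie o w)
    {f : Cocycles1 k (QuotAlgebra I)} (hf : f ∈ relCocycles I) :
    ∃ c : Arrow V → k, ∀ e : Arrow V, ¬ (e.1 = o ∧ e.2.1 = w) →
      f.1 (pathClass I e.2.2.toPath) = c e • pathClass I e.2.2.toPath := by
  have h : ∀ e : Arrow V, ∃ c : k, ¬ (e.1 = o ∧ e.2.1 = w) →
      f.1 (pathClass I e.2.2.toPath) = c • pathClass I e.2.2.toPath := fun e => by
    by_cases he : e.1 = o ∧ e.2.1 = w
    · exact ⟨0, fun h => absurd he h⟩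
    · have := hQ.subsingleton_path he
      obtain ⟨c, hc⟩ := exists_smul_of_mem_corner e.2.2.toPath
        (relCocycles_map_mem_corner hf (pathClass_mem_corner e.2.2.toPath))
      exact ⟨c, fun _ => hc⟩
  choose c hc using h
  exact ⟨c, hc⟩

/-- The space of linear relations in `A` between the paths from `x` to `y`. -/
def branchRelations (I : Ideal (PathAlgebra k V)) (x y : V) : Submodule k (Path x y →₀ k) :=
  (I.restrictScalars k).comap
    (Finsupp.linearCombination k fun p => PathAlgebra.ofPath (k := k) ⟨x, y, p⟩)

omit [I.IsTwoSided] in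
theorem mem_branchRelations {x y : V} {v : Path x y →₀ k} :
    v ∈ branchRelations I x y ↔ branchCombination v ∈ I := Iff.rfl

theorem mem_branchRelations_iff_sum {x y : V} {v : Path x y →₀ k} :
    v ∈ branchRelations I x y ↔ (v.sum fun p r => r • pathClass I p) = 0 := by
  rw [mem_branchRelations, ← quotMk_eq_zero, branchCombination, map_finsuppSum]
  simp only [map_smul, quotMk_ofPath]

theorem coeff_branchCombination {x y : V} (v : Path x y →₀ k) (p : Path x y) :
    (branchCombination v).coeff ⟨x, y, p⟩ = v p := by
  have h : (branchCombination v).coeff ⟨x, y, p⟩ =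
      (Finsupp.lapply (⟨x, y, p⟩ : QPath V) : (QPath V →₀ k) →ₗ[k] k)
        (Finsupp.linearCombination k (fun p => (Finsupp.single ⟨x, y, p⟩ 1 : QPath V →₀ k)) v) :=
    rfl
  classical
  rw [h, Finsupp.linearCombination_apply, map_finsuppSum]
  simp only [map_smul, Finsupp.lapply_apply, Finsupp.single_apply, Sigma.mk.injEq, heq_eq_eq,
    true_and, smul_eq_mul, mul_ite, mul_one, mul_zero]
  rw [Finsupp.sum_ite_self_eq']

omit [I.IsTwoSided] in
theorem IsAdmissible.two_le_length_of_mem (hI : IsAdmissible I) {x y : V} {v : Path x y →₀ k}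
    (hv : v ∈ branchRelations I x y) {p : Path x y} (hp : v p ≠ 0) : 2 ≤ p.length :=
  hI.two_le_length _ (mem_branchRelations.1 hv) ⟨x, y, p⟩ (by rwa [coeff_branchCombination])

theorem freeDer_branchCombination (g : Arrow V → QuotAlgebra I) {x y : V} {v : Path x y →₀ k}
    {μ : Path x y → k} (h : ∀ p, v p ≠ 0 → pathDer g p = μ p • pathClass I p) :
    freeDer g (branchCombination v) = quotMk I (branchCombination (μ • v)) := by
  rw [branchCombination, branchCombination, map_finsuppSum, map_finsuppSum,
    Finsupp.sum_of_support_subset (μ • v) (s := v.support)]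
  · refine Finset.sum_congr rfl fun p hp => ?_
    dsimp only
    rw [map_smul, map_smul, freeDer_ofPath, quotMk_ofPath, h p (Finsupp.mem_support_iff.1 hp),
      smul_smul, Finsupp.coe_pointwise_smul, Pi.smul_apply', smul_eq_mul, mul_comm]
  · intro p hp
    rw [Finsupp.mem_support_iff, Finsupp.coe_pointwise_smul, Pi.smul_apply', smul_eq_mul] at hp
    exact Finsupp.mem_support_iff.2 (right_ne_zero_of_mul hp)
  · simp

end Weight

/-! ### Cocycles and stability of the relations -/

section Extension

variable {k : Type*} {V : Type*} [Quiver V] [Field k] [Fintype V]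
variable {I : Ideal (PathAlgebra k V)} [I.IsTwoSided] {o w : V}

/-- A cochain on arrows is a cocycle as soon as the relations between branches are stable under the
multiplication by the weights of the branches. -/
theorem IsToupie.exists_extends (hQ : IsToupie o w) (hI : IsAdmissible I)
    {g : Arrow V → QuotAlgebra I} (hg : ∀ e, g e ∈ corner I e.1 e.2.1) {c : Arrow V → k}
    (hc : ∀ e : Arrow V, ¬ (e.1 = o ∧ e.2.1 = w) → g e = c e • pathClass I e.2.2.toPath)
    (hstable : ∀ v ∈ branchRelations I o w, (pathWeight c : Path o w → k) • v ∈
      branchRelations I o w) :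
    ∃ f : Cocycles1 k (QuotAlgebra I), Extends I g f := by
  refine exists_cocycle_of_freeDer hg fun a ha => eq_zero_of_mem_ideal _ (fun x y v hv => ?_) ha
  rw [freeDer_branchCombination g (μ := pathWeight c) fun p hp => hQ.pathDer_eq_weight hc p
    fun h => by have := hI.two_le_length_of_mem hv hp; omega, quotMk_eq_zero]
  by_cases h : x = o ∧ y = w
  · obtain ⟨rfl, rfl⟩ := h
    exact hstable v hv
  -- Away from `(o, w)` there is at most one path from `x` to `y`, so the weights rescale the
  -- relation by one scalar.
  · have := hQ.subsingleton_path h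
    obtain hp | ⟨⟨p⟩⟩ := isEmpty_or_nonempty (Path x y)
    · rw [Subsingleton.elim ((pathWeight c : Path x y → k) • v) v]
      exact hv
    · have hs : (pathWeight c : Path x y → k) • v = pathWeight c p • v := by
        ext q
        rw [Subsingleton.elim q p]
        simp
      rw [hs]
      exact (branchRelations I x y).smul_mem _ hv

/-- Necessity of the stability condition: a cocycle applied to a vanishing combination of branches
gives `0`, and its value is the same combination rescaled by the weights. Admissibility keeps single
arrows out of the relation. -/
theorem IsToupie.weight_smul_mem (hQ : IsToupie o w) (hI : IsAdmissible I)
    {f : Cocycles1 k (QuotAlgebra I)} (hf : f ∈ relCocycles I) {c : Arrow V → k}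
    (hc : ∀ e : Arrow V, ¬ (e.1 = o ∧ e.2.1 = w) →
      f.1 (pathClass I e.2.2.toPath) = c e • pathClass I e.2.2.toPath)
    {v : Path o w →₀ k} (hv : v ∈ branchRelations I o w) :
    (pathWeight c : Path o w → k) • v ∈ branchRelations I o w := by
  rw [mem_branchRelations, ← quotMk_eq_zero, ← freeDer_branchCombination
    (fun e => f.1 (pathClass I e.2.2.toPath)) fun p hp => hQ.pathDer_eq_weight hc p
    fun h => by have := hI.two_le_length_of_mem hv hp; omega]
  have h := congrArg f.1 (mem_branchRelations_iff_sum.1 hv)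
  rw [map_finsuppSum, map_zero] at h
  rw [← h, branchCombination, map_finsuppSum]
  refine Finset.sum_congr rfl fun p _ => ?_
  dsimp only
  rw [map_smul, map_smul, freeDer_ofPath, relCocycles_apply_pathClass hf]

end Extension

end Toupie

end

noncomputable section

namespace Toupie

open Quiver

/-! ### Reduced row echelon form and the graph `Q_ρ` -/

section Reduction

variable {k : Type*} {V : Type*} [Quiver V] [Field k] [Fintype V]
variable {I : Ideal (PathAlgebra k V)} {o w : V} [LinearOrder (Path o w)]

omit [LinearOrder (Path o w)] in
theorem branchCombination_single (b : Path o w) :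
    branchCombination (Finsupp.single b (1 : k)) = PathAlgebra.ofPath ⟨o, w, b⟩ := by
  rw [branchCombination_eq, Finsupp.linearCombination_single, one_smul]

omit [LinearOrder (Path o w)] in
theorem ContainsMonomialRelation.single_mem [I.IsTwoSided] {b : Path o w}
    (h : ContainsMonomialRelation I b) : Finsupp.single b 1 ∈ branchRelations I o w := by
  obtain ⟨x, y, p, q, r, rfl, hq⟩ := h
  rw [mem_branchRelations, branchCombination_single, ← PathAlgebra.ofPath_mul,
    ← PathAlgebra.ofPath_mul]
  exact I.mul_mem_right _ (I.mul_mem_left _ hq)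

theorem isLeadingBranch_of_single_mem {b : Path o w}
    (h : Finsupp.single b 1 ∈ branchRelations I o w) : IsLeadingBranch I b :=
  ⟨Finsupp.single b 1, h, by simp, fun _ hc => Finsupp.single_eq_of_ne hc.ne⟩

/-- The first branch occurring in a nonzero relation is a leading branch. All uniqueness statements
on reduced relations rest on this. -/
theorem branchRelations_eq_zero {v : Path o w →₀ k} (hv : v ∈ branchRelations I o w)
    (h : ∀ c, IsLeadingBranch I c → v c = 0) : v = 0 := by
  by_contra h0
  have hne : v.support.Nonempty := Finsupp.support_nonempty_iff.2 h0
  refine Finsupp.mem_support_iff.1 (v.support.min'_mem hne) (h _ ⟨v, hv, ?_, fun c hc => ?_⟩)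
  · exact Finsupp.mem_support_iff.1 (v.support.min'_mem hne)
  · by_contra h
    exact absurd (v.support.min'_le c (Finsupp.mem_support_iff.2 h)) (not_le.2 hc)

/-- The reduction of a branch to a linear combination of irreducible branches. -/
theorem exists_reduction [Finite (Path o w)] (b : Path o w) :
    ∃ u : Path o w →₀ k, (∀ c, IsLeadingBranch I c → u c = 0) ∧
      Finsupp.single b 1 - u ∈ branchRelations I o w := by
  induction b using (Finite.to_wellFoundedGT (α := Path o w)).wf.induction with
  | _ b ih =>
  by_cases hb : IsLeadingBranch I b
  · obtain ⟨v, hv, hvb, hlt⟩ := hb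
    choose! u hu hu' using ih
    have := Fintype.ofFinite (Path o w)
    -- Solve `v` for its leading branch `b` and replace every later branch by its reduction. For `c
    -- < b` the coefficient `v c` is `0`, so the unspecified `u c` is harmless.
    refine ⟨∑ c ∈ Finset.univ.erase b, -((v b)⁻¹ * v c) • u c, fun d hd => ?_, ?_⟩
    · rw [Finsupp.finsetSum_apply]
      refine Finset.sum_eq_zero fun c hc => ?_
      obtain h | h := lt_or_gt_of_ne (Finset.ne_of_mem_erase hc)
      · simp [hlt c h]
      · simp [hu c h d hd]
    · have hsum : Finsupp.single b 1 - ∑ c ∈ Finset.univ.erase b, -((v b)⁻¹ * v c) • u c =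
          (v b)⁻¹ • v - ∑ c ∈ Finset.univ.erase b,
            ((v b)⁻¹ * v c) • (Finsupp.single c 1 - u c) := by
        have h : (v b)⁻¹ • v = ∑ c, ((v b)⁻¹ * v c) • Finsupp.single c 1 := by
          conv_lhs => rw [← Finsupp.univ_sum_single v, Finset.smul_sum]
          simp
        rw [h, ← Finset.add_sum_erase _ _ (Finset.mem_univ b), inv_mul_cancel₀ hvb, one_smul]
        simp only [smul_sub, Finset.sum_sub_distrib, neg_smul, Finset.sum_neg_distrib]
        abel
      rw [hsum]
      refine sub_mem (Submodule.smul_mem _ _ hv) (sum_mem fun c hc => ?_)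
      obtain h | h := lt_or_gt_of_ne (Finset.ne_of_mem_erase hc)
      · simp [hlt c h]
      · exact Submodule.smul_mem _ _ (hu' c h)
  · refine ⟨Finsupp.single b 1, fun c hc => Finsupp.single_eq_of_ne fun h => hb (h ▸ hc), ?_⟩
    simp

theorem exists_reducedRelation [Finite (Path o w)] {b : Path o w} (hb : IsLeadingBranch I b) :
    ∃ v, IsReducedRelation I v ∧ v b = 1 ∧ ∀ c, IsLeadingBranch I c → c ≠ b → v c = 0 := by
  obtain ⟨u, hu, hmem⟩ := exists_reduction (I := I) b
  have h1 : (Finsupp.single b 1 - u : Path o w →₀ k) b = 1 := by simp [hu b hb]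
  have h2 : ∀ c, IsLeadingBranch I c → c ≠ b → (Finsupp.single b 1 - u : Path o w →₀ k) c = 0 := by
    intro c hc hne
    rw [Finsupp.sub_apply, hu c hc, Finsupp.single_eq_of_ne hne, sub_zero]
  exact ⟨_, ⟨hmem, b, hb, h1, h2⟩, h1, h2⟩

/-- Subtracting `v b` times the reduced relation of each leading branch `b` leaves a relation
without leading branches, which is zero. -/
theorem branchRelations_le_span [Finite (Path o w)] :
    branchRelations I o w ≤ Submodule.span k {v | IsReducedRelation I v} := by
  classical
  intro v hv
  have := Fintype.ofFinite (Path o w)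
  have h : ∀ b, ∃ r : Path o w →₀ k, IsLeadingBranch I b → IsReducedRelation I r ∧ r b = 1 ∧
      ∀ c, IsLeadingBranch I c → c ≠ b → r c = 0 := fun b => by
    by_cases hb : IsLeadingBranch I b
    · obtain ⟨r, hr⟩ := exists_reducedRelation hb
      exact ⟨r, fun _ => hr⟩
    · exact ⟨0, fun h => absurd h hb⟩
  choose r hr using h
  have hv' : v = ∑ b with IsLeadingBranch I b, v b • r b := by
    refine sub_eq_zero.1 (branchRelations_eq_zero (I := I) (sub_mem hv (sum_mem fun b hb =>
      Submodule.smul_mem _ _ (hr b (Finset.mem_filter.1 hb).2).1.1)) fun c hc => ?_)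
    rw [Finsupp.sub_apply, Finsupp.finsetSum_apply, Finset.sum_eq_single c]
    · simp [(hr c hc).2.1]
    · intro b hb hne
      rw [Finsupp.smul_apply, (hr b (Finset.mem_filter.1 hb).2).2.2 c hc hne.symm, smul_zero]
    · simp [hc]
  rw [hv']
  exact sum_mem fun b hb => Submodule.smul_mem _ _
    (Submodule.subset_span (hr b (Finset.mem_filter.1 hb).2).1)

/-- Multiplication by a function of the branches preserves the relations if the function is
constant on each reduced relation. -/
theorem pointwise_smul_mem [Finite (Path o w)] {μ : Path o w → k}
    (h : ∀ v, IsReducedRelation I v → ∀ b c, v b ≠ 0 → v c ≠ 0 → μ b = μ c)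
    {v : Path o w →₀ k} (hv : v ∈ branchRelations I o w) : μ • v ∈ branchRelations I o w := by
  refine Submodule.span_induction (p := fun v _ => μ • v ∈ branchRelations I o w) ?_ (by simp)
    (fun _ _ _ _ h h' => by rw [smul_add]; exact add_mem h h')
    (fun r v _ h => ?_) (branchRelations_le_span hv)
  · intro v hr
    obtain ⟨b, -, hb, -⟩ := hr.2
    have : μ • v = μ b • v := by
      ext c
      rw [Finsupp.coe_pointwise_smul, Pi.smul_apply', Finsupp.smul_apply]
      by_cases hc : v c = 0
      · rw [hc, smul_zero, smul_zero]
      · rw [h v hr c b hc (by simp [hb])]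
    rw [this]
    exact Submodule.smul_mem _ _ hr.1
  · have : μ • r • v = r • μ • v := by
      ext c
      simp [mul_left_comm]
    rw [this]
    exact Submodule.smul_mem _ _ h

/-- With `a` the leading branch of `v`, the relation `μ • v - μ a • v` involves no leading branch,
hence vanishes. This is the converse of `pointwise_smul_mem`. -/
theorem IsReducedRelation.eq_of_stable {μ : Path o w → k}
    (h : ∀ v ∈ branchRelations I o w, μ • v ∈ branchRelations I o w)
    {v : Path o w →₀ k} (hv : IsReducedRelation I v) {b c : Path o w} (hb : v b ≠ 0)
    (hc : v c ≠ 0) : μ b = μ c := by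
  obtain ⟨hmem, a, ha, ha1, ha0⟩ := hv
  have hz : μ • v - μ a • v = 0 := branchRelations_eq_zero (I := I)
    (sub_mem (h v hmem) (Submodule.smul_mem _ _ hmem)) fun d hd => by
      by_cases hda : d = a
      · subst hda
        simp
      · simp [ha0 d hd hda]
  have key : ∀ b, v b ≠ 0 → μ b = μ a := fun b hb => by
    have := DFunLike.congr_fun hz b
    simpa [← sub_mul, hb, sub_eq_zero] using this
  rw [key b hb, key c hc]

/-- A branch that lies in `I` is a leading branch, so `b` is the leading branch of `v`; then `v`
minus the single branch `b` has no leading branches left. -/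
theorem IsReducedRelation.eq_single {v : Path o w →₀ k} (hv : IsReducedRelation I v) {b : Path o w}
    (hb : v b ≠ 0) (h : Finsupp.single b 1 ∈ branchRelations I o w) : v = Finsupp.single b 1 := by
  obtain ⟨hmem, a, ha, ha1, ha0⟩ := hv
  obtain rfl : b = a := by
    by_contra hne
    exact hb (ha0 b (isLeadingBranch_of_single_mem h) hne)
  refine sub_eq_zero.1 (branchRelations_eq_zero (I := I) (sub_mem hmem h) fun c hc => ?_)
  by_cases hcb : c = b
  · subst hcb
    simp [ha1]
  · rw [Finsupp.sub_apply, ha0 c hc hcb, Finsupp.single_eq_of_ne hcb, sub_zero]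

/-- The branches that form a connected component of `Q_ρ`. -/
def componentBranches (h : (rhoGraph I o w).ConnectedComponent) : Set (Path o w) :=
  Subtype.val '' h.supp

variable [I.IsTwoSided]

/-- Two branches of a reduced relation are equal, or they are adjacent vertices of `Q_ρ`. -/
theorem IsReducedRelation.eq_or_adj (hI : IsAdmissible I) {v : Path o w →₀ k}
    (hv : IsReducedRelation I v) {b c : Path o w} (hb : v b ≠ 0) (hc : v c ≠ 0) :
    b = c ∨ ∃ (hb' : 2 ≤ b.length ∧ ¬ ContainsMonomialRelation I b)
      (hc' : 2 ≤ c.length ∧ ¬ ContainsMonomialRelation I c),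
      (rhoGraph I o w).Adj ⟨b, hb'⟩ ⟨c, hc'⟩ := by
  refine or_iff_not_imp_left.2 fun hne => ?_
  have key : ∀ b c, b ≠ c → v b ≠ 0 → v c ≠ 0 → ¬ ContainsMonomialRelation I b := by
    intro b c hne hb hc h
    rw [hv.eq_single hb h.single_mem] at hc
    exact hc (Finsupp.single_eq_of_ne hne.symm)
  exact ⟨⟨hI.two_le_length_of_mem hv.1 hb, key b c hne hb hc⟩,
    ⟨hI.two_le_length_of_mem hv.1 hc, key c b (Ne.symm hne) hc hb⟩,
    fun h => hne (congrArg Subtype.val h), v, hv, hb, hc⟩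

/-- This makes the indicator function of a component constant on the support of every reduced
relation, so that `t_h` is a cocycle. -/
theorem componentBranches_stable (hI : IsAdmissible I) (h : (rhoGraph I o w).ConnectedComponent)
    {v : Path o w →₀ k} (hv : IsReducedRelation I v) {b c : Path o w} (hb : v b ≠ 0)
    (hc : v c ≠ 0) : b ∈ componentBranches h ↔ c ∈ componentBranches h := by
  obtain rfl | ⟨hb', hc', hadj⟩ := hv.eq_or_adj hI hb hc
  · rfl
  · have hbc : ∀ (b : Path o w) (hb : 2 ≤ b.length ∧ ¬ ContainsMonomialRelation I b),
        b ∈ componentBranches h ↔ (⟨b, hb⟩ : RhoVertex I o w) ∈ h.supp := fun b hb =>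
      Subtype.val_injective.mem_set_image (a := (⟨b, hb⟩ : RhoVertex I o w))
    rw [hbc b hb', hbc c hc', SimpleGraph.ConnectedComponent.mem_supp_iff,
      SimpleGraph.ConnectedComponent.mem_supp_iff,
      SimpleGraph.ConnectedComponent.eq.2 hadj.reachable]

omit [I.IsTwoSided] in
theorem eq_of_reachable {μ : Path o w → k}
    (h : ∀ v ∈ branchRelations I o w, μ • v ∈ branchRelations I o w) {b c : RhoVertex I o w}
    (hbc : (rhoGraph I o w).Reachable b c) : μ b.1 = μ c.1 := by
  obtain ⟨p⟩ := hbc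
  induction p with
  | nil => rfl
  | cons hadj _ ih =>
    obtain ⟨-, v, hv, hb, hc⟩ := hadj
    rw [← ih, hv.eq_of_stable h hb hc]

end Reduction

end Toupie

end

noncomputable section

namespace Toupie

open Quiver

/-! ### Branches and their first arrows -/

section FirstArrow

variable {V : Type*} [Quiver V]

theorem exists_of_firstArrow_eq {x y : V} {p : Path x y} {e : Arrow V} (h : firstArrow p = some e) :
    ∃ (z : V) (f : x ⟶ z) (r : Path z y), e = ⟨x, z, f⟩ ∧ p = f.toPath.comp r := by
  obtain hp | hp := Nat.eq_zero_or_pos p.length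
  · obtain rfl := Path.eq_of_length_zero p hp
    rw [Path.eq_nil_of_length_zero p hp] at h
    cases h
  · obtain ⟨z, f, r, rfl⟩ := exists_eq_toPath_comp p hp
    rw [firstArrow_toPath_comp] at h
    exact ⟨z, f, r, (Option.some.inj h).symm, rfl⟩

variable {o w : V} (hQ : IsToupie o w)
include hQ

theorem IsToupie.eq_of_firstArrow {b c : Path o w} {e : Arrow V} (hb : firstArrow b = some e)
    (hc : firstArrow c = some e) : b = c := by
  obtain ⟨y, f, r, rfl, rfl⟩ := exists_of_firstArrow_eq hb
  obtain ⟨z, g, s, h, rfl⟩ := exists_of_firstArrow_eq hc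
  cases h
  exact hQ.branch_eq_of_first f r s

/-- The first arrow of a branch of length at least two does not end at the sink. -/
theorem IsToupie.firstArrow_ne {b : Path o w} (hb : 2 ≤ b.length) (u : o ⟶ w) :
    firstArrow b ≠ some ⟨o, w, u⟩ := fun h => by
  rw [hQ.eq_of_firstArrow h (firstArrow_toPath_comp u .nil)] at hb
  simp at hb

end FirstArrow

/-! ### Cochains that scale first arrows, and values of the given cochains -/

section DiagCochain

variable {k : Type*} {V : Type*} [Quiver V] [Field k] {o w : V}

open Classical in
/-- The function on arrows with a given value at the first arrow of each branch, and `0` at the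
arrows that are not the first arrow of a branch. -/
def firstScalar (μ : Path o w → k) (e : Arrow V) : k :=
  if h : ∃ b : Path o w, firstArrow b = some e then μ h.choose else 0

theorem firstScalar_of_forall_ne (μ : Path o w → k) {e : Arrow V}
    (h : ∀ b : Path o w, firstArrow b ≠ some e) : firstScalar μ e = 0 :=
  dif_neg fun ⟨b, hb⟩ => h b hb

theorem firstScalar_of_source_ne (μ : Path o w → k) {e : Arrow V} (h : e.1 ≠ o) :
    firstScalar μ e = 0 :=
  firstScalar_of_forall_ne μ fun b hb => by
    obtain ⟨z, f, r, rfl, -⟩ := exists_of_firstArrow_eq hb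
    exact h rfl

theorem IsToupie.firstScalar_eq (hQ : IsToupie o w) (μ : Path o w → k) {e : Arrow V}
    {b : Path o w} (hb : firstArrow b = some e) : firstScalar μ e = μ b := by
  have h : ∃ b : Path o w, firstArrow b = some e := ⟨b, hb⟩
  rw [firstScalar, dif_pos h, hQ.eq_of_firstArrow h.choose_spec hb]

theorem IsToupie.pathWeight_eq_zero (hQ : IsToupie o w) {c : Arrow V → k}
    (hc : ∀ e : Arrow V, e.1 ≠ o → c e = 0) {x y : V} (hx : x ≠ o) (p : Path x y) :
    pathWeight c p = 0 := by
  induction p with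
  | nil => rfl
  | @cons y z p e ih =>
    rw [pathWeight, ih, zero_add]
    refine hc _ ?_
    cases p with
    | nil => exact hx
    | cons p f => exact hQ.target_ne_source f

theorem IsToupie.pathWeight_branch (hQ : IsToupie o w) {c : Arrow V → k}
    (hc : ∀ e : Arrow V, e.1 ≠ o → c e = 0) {b : Path o w} {e : Arrow V}
    (hb : firstArrow b = some e) : pathWeight c b = c e := by
  obtain ⟨z, f, r, rfl, rfl⟩ := exists_of_firstArrow_eq hb
  rw [pathWeight_comp, pathWeight_toPath, hQ.pathWeight_eq_zero hc (hQ.target_ne_source f),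
    add_zero]

/-- Later arrows of a branch do not start at `o` and weigh nothing, so any function on branches is
the weight of a choice of scalars on first arrows. -/
theorem IsToupie.pathWeight_firstScalar (hQ : IsToupie o w) (how : o ≠ w) (μ : Path o w → k) :
    (pathWeight (firstScalar μ) : Path o w → k) = μ := by
  ext b
  obtain ⟨z, f, r, rfl⟩ := exists_eq_toPath_comp b
    (Nat.pos_of_ne_zero fun h => how (Path.eq_of_length_zero b h))
  rw [hQ.pathWeight_branch (fun e => firstScalar_of_source_ne μ) (firstArrow_toPath_comp f r),
    hQ.firstScalar_eq μ (firstArrow_toPath_comp f r)]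

variable [Fintype V] (I : Ideal (PathAlgebra k V)) [I.IsTwoSided]

/-- The cochain that multiplies the first arrow of each branch `b` by `μ b`. -/
def diagCochain (μ : Path o w → k) (e : Arrow V) : QuotAlgebra I :=
  firstScalar μ e • pathClass I e.2.2.toPath

open Classical in
theorem firstCochain_apply {x y : V} (b : Path x y) (e : Arrow V) :
    firstCochain I b e = if firstArrow b = some e then pathClass I e.2.2.toPath else 0 := by
  unfold firstCochain
  cases h : firstArrow b with
  | none => simp
  | some f =>
    simp only [Option.some.injEq, parallel]
    by_cases hef : e = f
    · subst hef
      simp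
    · rw [if_neg hef, if_neg (Ne.symm hef)]

open Classical in
theorem IsToupie.firstCochain_eq (hQ : IsToupie o w) (b : Path o w) :
    firstCochain I b = diagCochain I (Pi.single b 1) := by
  ext e
  rw [firstCochain_apply, diagCochain]
  by_cases h : ∃ c : Path o w, firstArrow c = some e
  · obtain ⟨c, hc⟩ := h
    rw [hQ.firstScalar_eq _ hc]
    by_cases hbc : c = b
    · subst hbc
      rw [if_pos hc, Pi.single_eq_same, one_smul]
    · rw [if_neg fun h => hbc (hQ.eq_of_firstArrow hc h), Pi.single_eq_of_ne hbc, zero_smul]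
  · rw [firstScalar_of_forall_ne _ fun c hc => h ⟨c, hc⟩, if_neg fun hb => h ⟨b, hb⟩, zero_smul]

open Classical in
-- Distinct branches have distinct first arrows, so at most one summand of `t_h` is nonzero on a
-- given arrow.
theorem IsToupie.tCochain_eq [LinearOrder (Path o w)] [Finite (Path o w)] (hQ : IsToupie o w)
    (h : (rhoGraph I o w).ConnectedComponent) :
    tCochain I h = diagCochain I ((componentBranches h).indicator 1) := by
  ext e
  have := Fintype.ofFinite h.supp
  rw [tCochain, finsum_eq_sum_of_fintype, Finset.sum_apply, diagCochain]
  simp only [firstCochain_apply]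
  by_cases he : ∃ c : Path o w, firstArrow c = some e
  · obtain ⟨c, hc⟩ := he
    rw [hQ.firstScalar_eq _ hc]
    by_cases hch : c ∈ componentBranches h
    · obtain ⟨d, hd, rfl⟩ := hch
      have hd' : d.1 ∈ componentBranches h := ⟨d, hd, rfl⟩
      rw [Set.indicator_of_mem hd', Pi.one_apply, one_smul,
        Finset.sum_eq_single (⟨d, hd⟩ : h.supp), if_pos hc]
      · intro b _ hb
        exact if_neg fun h => hb (Subtype.ext (Subtype.ext (hQ.eq_of_firstArrow h hc)))
      · simp
    · rw [Set.indicator_of_notMem hch, zero_smul]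
      refine Finset.sum_eq_zero fun b _ => if_neg fun hb => hch ?_
      rw [hQ.eq_of_firstArrow hc hb]
      exact ⟨b.1, b.2, rfl⟩
  · rw [firstScalar_of_forall_ne _ fun c hc => he ⟨c, hc⟩, zero_smul]
    exact Finset.sum_eq_zero fun b _ => if_neg fun hb => he ⟨_, hb⟩

variable {I}

theorem parallel_self (e : Arrow V) (a : QuotAlgebra I) : parallel I e a e = a := if_pos rfl

theorem parallel_of_ne {e f : Arrow V} (h : f ≠ e) (a : QuotAlgebra I) : parallel I e a f = 0 :=
  if_neg h

theorem zCochain_self (u : o ⟶ w) (s : Path o w) :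
    zCochain I u s ⟨o, w, u⟩ = pathClass I s := parallel_self _ _

theorem zCochain_of_ne {u : o ⟶ w} {e : Arrow V} (h : e ≠ ⟨o, w, u⟩) (s : Path o w) :
    zCochain I u s e = 0 := parallel_of_ne h _

theorem matrixCochain_apply {a : ℕ} (α : Fin a ≃ (o ⟶ w)) (M : Matrix (Fin a) (Fin a) k)
    (p : Fin a) : matrixCochain I α M ⟨o, w, α p⟩ = ∑ q, M q p • pathClass I (α q).toPath := by
  simp only [matrixCochain, Finset.sum_apply, Pi.smul_apply]
  rw [Finset.sum_eq_single p]
  · simp only [parallel_self]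
  · intro q _ hq
    refine Finset.sum_eq_zero fun r _ => ?_
    rw [parallel_of_ne, smul_zero]
    intro h
    exact hq (α.injective (by simpa using h.symm))
  · simp

theorem matrixCochain_of_ne {a : ℕ} (α : Fin a ≃ (o ⟶ w)) (M : Matrix (Fin a) (Fin a) k)
    {e : Arrow V} (h : ¬ (e.1 = o ∧ e.2.1 = w)) : matrixCochain I α M e = 0 := by
  simp only [matrixCochain, Finset.sum_apply, Pi.smul_apply]
  refine Finset.sum_eq_zero fun p _ => Finset.sum_eq_zero fun q _ => ?_
  rw [parallel_of_ne, smul_zero]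
  rintro rfl
  exact h ⟨rfl, rfl⟩

end DiagCochain

/-! ### The given cochains are cocycles -/

section Existence

variable {k : Type*} {V : Type*} [Quiver V] [Field k] [Fintype V]
variable {I : Ideal (PathAlgebra k V)} [I.IsTwoSided] {o w : V}

theorem IsToupie.isArrowCocycle_diagCochain [LinearOrder (Path o w)] [Finite (Path o w)]
    (hQ : IsToupie o w) (hI : IsAdmissible I) (how : o ≠ w) {μ : Path o w → k}
    (h : ∀ v, IsReducedRelation I v → ∀ b c, v b ≠ 0 → v c ≠ 0 → μ b = μ c) :
    IsArrowCocycle I (diagCochain I μ) :=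
  hQ.exists_extends hI
    (fun e => Submodule.smul_mem _ _ (pathClass_mem_corner e.2.2.toPath)) (fun _ _ => rfl)
    fun v hv => by
      rw [hQ.pathWeight_firstScalar how]
      exact pointwise_smul_mem h hv

/-- Relations involve only paths of length at least two, which contain no arrow from `o` to `w`. The
values on these arrows are therefore unconstrained within `e_o A e_w`; all relevant weights are `0`.
-/
theorem IsToupie.isArrowCocycle_of_corner (hQ : IsToupie o w) (hI : IsAdmissible I)
    {g : Arrow V → QuotAlgebra I} (h0 : ∀ e : Arrow V, ¬ (e.1 = o ∧ e.2.1 = w) → g e = 0)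
    (hg : ∀ u : o ⟶ w, g ⟨o, w, u⟩ ∈ corner I o w) : IsArrowCocycle I g := by
  refine hQ.exists_extends hI (c := 0) (fun e => ?_) (fun e he => by simp [h0 e he])
    fun v hv => ?_
  · by_cases he : e.1 = o ∧ e.2.1 = w
    · obtain ⟨x, y, u⟩ := e
      obtain ⟨rfl, rfl⟩ := he
      exact hg u
    · rw [h0 e he]
      exact zero_mem _
  · have hz : ∀ {x y : V} (p : Path x y), pathWeight (0 : Arrow V → k) p = 0 := fun p => by
      induction p with
      | nil => rfl
      | cons p e ih => rw [pathWeight, ih, Pi.zero_apply, add_zero]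
    have : (pathWeight 0 : Path o w → k) • v = 0 := by
      ext b
      simp [hz]
    rw [this]
    exact zero_mem _

theorem IsToupie.isArrowCocycle_zCochain (hQ : IsToupie o w) (hI : IsAdmissible I) (u : o ⟶ w)
    (s : Path o w) : IsArrowCocycle I (zCochain I u s) := by
  refine hQ.isArrowCocycle_of_corner hI (fun e he => zCochain_of_ne (fun h => ?_) s) fun u' => ?_
  · exact he (by rw [h]; exact ⟨rfl, rfl⟩)
  · by_cases h : (⟨o, w, u'⟩ : Arrow V) = ⟨o, w, u⟩
    · rw [h, zCochain_self]
      exact pathClass_mem_corner s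
    · rw [zCochain_of_ne h]
      exact zero_mem _

theorem IsToupie.isArrowCocycle_matrixCochain (hQ : IsToupie o w) (hI : IsAdmissible I) {a : ℕ}
    (α : Fin a ≃ (o ⟶ w)) (M : Matrix (Fin a) (Fin a) k) :
    IsArrowCocycle I (matrixCochain I α M) := by
  refine hQ.isArrowCocycle_of_corner hI (fun e he => matrixCochain_of_ne α M he) fun u => ?_
  obtain ⟨p, rfl⟩ := α.surjective u
  rw [matrixCochain_apply]
  exact sum_mem fun q _ => Submodule.smul_mem _ _ (pathClass_mem_corner _)

variable [LinearOrder (Path o w)] [Finite (Path o w)]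

theorem IsToupie.isArrowCocycle_tCochain (hQ : IsToupie o w) (hI : IsAdmissible I) (how : o ≠ w)
    (h : (rhoGraph I o w).ConnectedComponent) : IsArrowCocycle I (tCochain I h) := by
  classical
  rw [hQ.tCochain_eq I]
  refine hQ.isArrowCocycle_diagCochain hI how fun v hv b c hb hc => ?_
  simp only [Set.indicator_apply, Pi.one_apply, componentBranches_stable hI h hv hb hc]

theorem IsToupie.isArrowCocycle_firstCochain (hQ : IsToupie o w) (hI : IsAdmissible I)
    (how : o ≠ w) {i : Path o w} (hi : ContainsMonomialRelation I i) :
    IsArrowCocycle I (firstCochain I i) := by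
  classical
  rw [hQ.firstCochain_eq I]
  refine hQ.isArrowCocycle_diagCochain hI how fun v hv b c hb hc => ?_
  -- Two different branches in a reduced relation are vertices of `Q_ρ`, so neither of them is `i`.
  obtain rfl | ⟨hb', hc', -⟩ := hv.eq_or_adj hI hb hc
  · rfl
  · rw [Pi.single_eq_of_ne, Pi.single_eq_of_ne]
    · rintro rfl
      exact hc'.2 hi
    · rintro rfl
      exact hb'.2 hi

end Existence

end Toupie

end

noncomputable section

namespace Toupie

open Quiver

/-! ### The subspaces of cocycles and their brackets -/

section Subspaces

variable {k : Type*} {V : Type*} [Quiver V] [Field k] [Fintype V]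
variable {I : Ideal (PathAlgebra k V)} [I.IsTwoSided] {o w : V}

variable (I) in
/-- The cocycles that vanish on all arrows that are not the first arrow of a branch in `T`. -/
def diagCocycles (T : Set (Path o w)) : Submodule k (Cocycles1 k (QuotAlgebra I)) where
  carrier := {f | f ∈ relCocycles I ∧
    ∀ e : Arrow V, (∀ b ∈ T, firstArrow b ≠ some e) → f.1 (pathClass I e.2.2.toPath) = 0}
  add_mem' {f g} hf hg := ⟨add_mem hf.1 hg.1, fun e he => by
    change f.1 _ + g.1 _ = 0
    rw [hf.2 e he, hg.2 e he, add_zero]⟩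
  zero_mem' := ⟨zero_mem _, fun _ _ => rfl⟩
  smul_mem' c f hf := ⟨(relCocycles I).smul_mem c hf.1, fun e he => by
    change c • f.1 _ = 0
    rw [hf.2 e he, smul_zero]⟩

variable (I o w) in
/-- The span of the irreducible branches of length at least two. -/
def longCorner [LinearOrder (Path o w)] : Submodule k (QuotAlgebra I) :=
  Submodule.span k (Set.range fun s : LongIrreducible I o w => pathClass I s.1)

variable (I o w) in
/-- The cocycles that vanish on all arrows but those from `o` to `w`, and map the latter to
combinations of branches of length at least two. -/
def radCocycles [LinearOrder (Path o w)] : Submodule k (Cocycles1 k (QuotAlgebra I)) where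
  carrier := {f | f ∈ relCocycles I ∧
    (∀ e : Arrow V, ¬ (e.1 = o ∧ e.2.1 = w) → f.1 (pathClass I e.2.2.toPath) = 0) ∧
    ∀ u : o ⟶ w, f.1 (pathClass I u.toPath) ∈ longCorner I o w}
  add_mem' {f g} hf hg := ⟨add_mem hf.1 hg.1, fun e he => by
    change f.1 _ + g.1 _ = 0
    rw [hf.2.1 e he, hg.2.1 e he, add_zero], fun u => add_mem (hf.2.2 u) (hg.2.2 u)⟩
  zero_mem' := ⟨zero_mem _, fun _ _ => rfl, fun _ => zero_mem (longCorner I o w)⟩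
  smul_mem' c f hf := ⟨(relCocycles I).smul_mem c hf.1, fun e he => by
    change c • f.1 _ = 0
    rw [hf.2.1 e he, smul_zero], fun u => Submodule.smul_mem _ c (hf.2.2 u)⟩

theorem sub_apply (f g : Cocycles1 k (QuotAlgebra I)) (a : QuotAlgebra I) :
    (f - g).1 a = f.1 a - g.1 a := rfl

theorem add_apply (f g : Cocycles1 k (QuotAlgebra I)) (a : QuotAlgebra I) :
    (f + g).1 a = f.1 a + g.1 a := rfl

theorem lie_apply (f g : Cocycles1 k (QuotAlgebra I)) (a : QuotAlgebra I) :
    (⁅f, g⁆ : Cocycles1 k (QuotAlgebra I)).1 a = f.1 (g.1 a) - g.1 (f.1 a) := rfl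

section Brackets

variable (hQ : IsToupie o w)
include hQ

theorem IsToupie.lie_apply_arrow {f g : Cocycles1 k (QuotAlgebra I)} (hf : f ∈ relCocycles I)
    (hg : g ∈ relCocycles I) {e : Arrow V} (he : ¬ (e.1 = o ∧ e.2.1 = w)) :
    (⁅f, g⁆ : Cocycles1 k (QuotAlgebra I)).1 (pathClass I e.2.2.toPath) = 0 := by
  obtain ⟨c, hc⟩ := hQ.exists_arrow_scalars hf
  obtain ⟨d, hd⟩ := hQ.exists_arrow_scalars hg
  rw [lie_apply, hc e he, hd e he, map_smul, map_smul, hc e he, hd e he, smul_comm, sub_self]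

/-- On every arrow not from `o` to `w` both cocycles act by scalars, which commute, so only the
arrows from `o` to `w` need testing. -/
theorem IsToupie.lie_eq_zero {f g : Cocycles1 k (QuotAlgebra I)} (hf : f ∈ relCocycles I)
    (hg : g ∈ relCocycles I)
    (h : ∀ u : o ⟶ w, f.1 (g.1 (pathClass I u.toPath)) = g.1 (f.1 (pathClass I u.toPath))) :
    ⁅f, g⁆ = 0 := by
  refine relCocycles_ext ((relCocycles I).lie_mem hf hg) (zero_mem _) fun e => ?_
  by_cases he : e.1 = o ∧ e.2.1 = w
  · obtain ⟨x, y, u⟩ := e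
    obtain ⟨rfl, rfl⟩ := he
    rw [lie_apply, h, sub_self]
    rfl
  · rw [hQ.lie_apply_arrow hf hg he]
    rfl

theorem IsToupie.diagCocycles_apply_arrow {T : Set (Path o w)} (hT : ∀ b ∈ T, 2 ≤ b.length)
    {f : Cocycles1 k (QuotAlgebra I)} (hf : f ∈ diagCocycles I T) (u : o ⟶ w) :
    f.1 (pathClass I u.toPath) = 0 :=
  hf.2 ⟨o, w, u⟩ fun b hb => hQ.firstArrow_ne (hT b hb) u

omit hQ in
theorem diagCocycles_apply_of_source_ne {T : Set (Path o w)} {f : Cocycles1 k (QuotAlgebra I)}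
    (hf : f ∈ diagCocycles I T) {e : Arrow V} (he : e.1 ≠ o) :
    f.1 (pathClass I e.2.2.toPath) = 0 :=
  hf.2 e fun b _ h => by
    obtain ⟨z, f, r, rfl, -⟩ := exists_of_firstArrow_eq h
    exact he rfl

theorem IsToupie.diagCocycles_apply_path {T : Set (Path o w)} {f : Cocycles1 k (QuotAlgebra I)}
    (hf : f ∈ diagCocycles I T) {x y : V} (hx : x ≠ o) (p : Path x y) :
    f.1 (pathClass I p) = 0 := by
  induction p with
  | nil => exact hf.1 x
  | @cons y z p e ih =>
    have he : y ≠ o := by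
      cases p with
      | nil => exact hx
      | cons p f => exact hQ.target_ne_source f
    rw [← Path.comp_toPath_eq_cons, ← pathClass_mul, Cocycles1.leibniz, ih,
      diagCocycles_apply_of_source_ne hf (e := ⟨y, z, e⟩) he, mul_zero, zero_mul, add_zero]

/-- The cocycles that act on the first arrows of branches with monomial relations are `0` on
`e_o A e_w`. -/
theorem IsToupie.diagCocycles_apply_corner (how : o ≠ w) {T : Set (Path o w)}
    (hT : ∀ b ∈ T, ContainsMonomialRelation I b) {f : Cocycles1 k (QuotAlgebra I)}
    (hf : f ∈ diagCocycles I T) {a : QuotAlgebra I} (ha : a ∈ corner I o w) : f.1 a = 0 := by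
  refine corner_induction (P := fun a => f.1 a = 0) (map_zero _)
    (fun _ _ h h' => by rw [map_add, h, h', add_zero])
    (fun c _ h => by rw [map_smul, h, smul_zero]) (fun b => ?_) ha
  obtain ⟨y, e, r, rfl⟩ := exists_eq_toPath_comp b
    (Nat.pos_of_ne_zero fun h => how (Path.eq_of_length_zero b h))
  -- A branch in `T` is zero in `A`; for any other branch `f` kills its first arrow as well as the
  -- rest.
  by_cases hb : e.toPath.comp r ∈ T
  · have h0 : pathClass I (e.toPath.comp r) = 0 := by
      have h := (hT _ hb).single_mem
      rw [mem_branchRelations, branchCombination_single] at h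
      exact quotMk_eq_zero.2 h
    rw [h0, map_zero]
  · rw [← pathClass_mul, Cocycles1.leibniz,
      hQ.diagCocycles_apply_path hf (hQ.target_ne_source e) r, hf.2 ⟨o, y, e⟩, mul_zero, zero_mul,
      add_zero]
    intro c hc h
    rw [hQ.eq_of_firstArrow h (firstArrow_toPath_comp e r)] at hc
    exact hb hc

/-- Centrality of `⟨C''₁⟩`: `f` preserves `e_o A e_w`, and `y` vanishes there. -/
theorem IsToupie.lie_diagCocycles_of_monomial (how : o ≠ w) {T : Set (Path o w)}
    (hT : ∀ b ∈ T, ContainsMonomialRelation I b) {f y : Cocycles1 k (QuotAlgebra I)}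
    (hf : f ∈ relCocycles I) (hy : y ∈ diagCocycles I T) : ⁅f, y⁆ = 0 := by
  refine hQ.lie_eq_zero hf hy.1 fun u => ?_
  rw [hQ.diagCocycles_apply_corner how hT hy (pathClass_mem_corner _), map_zero,
    hQ.diagCocycles_apply_corner how hT hy
      (relCocycles_map_mem_corner hf (pathClass_mem_corner _))]

theorem IsToupie.lie_diagCocycles {T : Set (Path o w)} (hT : ∀ b ∈ T, 2 ≤ b.length)
    {f g : Cocycles1 k (QuotAlgebra I)} (hf : f ∈ diagCocycles I T) (hg : g ∈ diagCocycles I T) :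
    ⁅f, g⁆ = 0 := by
  refine hQ.lie_eq_zero hf.1 hg.1 fun u => ?_
  rw [hQ.diagCocycles_apply_arrow hT hf, hQ.diagCocycles_apply_arrow hT hg, map_zero, map_zero]

variable [LinearOrder (Path o w)]

theorem IsToupie.relCocycles_map_longCorner {f : Cocycles1 k (QuotAlgebra I)}
    (hf : f ∈ relCocycles I) {a : QuotAlgebra I} (ha : a ∈ longCorner I o w) :
    f.1 a ∈ longCorner I o w := by
  obtain ⟨c, hc⟩ := hQ.exists_arrow_scalars hf
  induction ha using Submodule.span_induction with
  | zero => rw [map_zero]; exact zero_mem _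
  | add _ _ _ _ h h' => rw [map_add]; exact add_mem h h'
  | smul r _ _ h => rw [map_smul]; exact Submodule.smul_mem _ r h
  | mem _ h =>
    obtain ⟨s, rfl⟩ := h
    dsimp only
    rw [hQ.relCocycles_apply_eq_weight hf hc s.1 fun h => by have := s.2.1; omega]
    exact Submodule.smul_mem _ _ (Submodule.subset_span ⟨s, rfl⟩)

theorem IsToupie.apply_longCorner_eq_zero {f : Cocycles1 k (QuotAlgebra I)}
    (hf : f ∈ relCocycles I)
    (h0 : ∀ e : Arrow V, ¬ (e.1 = o ∧ e.2.1 = w) → f.1 (pathClass I e.2.2.toPath) = 0)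
    {a : QuotAlgebra I} (ha : a ∈ longCorner I o w) : f.1 a = 0 := by
  induction ha using Submodule.span_induction with
  | zero => rw [map_zero]
  | add _ _ _ _ h h' => rw [map_add, h, h', add_zero]
  | smul r _ _ h => rw [map_smul, h, smul_zero]
  | mem _ h =>
    obtain ⟨s, rfl⟩ := h
    refine hQ.path_induction (P := fun p => f.1 (pathClass I p) = 0) (hf o)
      (fun p e he ih => ?_) s.1 fun h => by have := s.2.1; omega
    rw [← Path.comp_toPath_eq_cons, ← pathClass_mul, Cocycles1.leibniz, ih, h0 ⟨_, _, e⟩ he,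
      mul_zero, zero_mul, add_zero]

theorem IsToupie.lie_radCocycles {f g : Cocycles1 k (QuotAlgebra I)} (hf : f ∈ radCocycles I o w)
    (hg : g ∈ radCocycles I o w) : ⁅f, g⁆ = 0 := by
  refine hQ.lie_eq_zero hf.1 hg.1 fun u => ?_
  rw [hQ.apply_longCorner_eq_zero hf.1 hf.2.1 (hg.2.2 u),
    hQ.apply_longCorner_eq_zero hg.1 hg.2.1 (hf.2.2 u)]

/-- `f` kills the arrows `u` from `o` to `w`, so the bracket sends `u` to `f (z u)`, and `f` is
diagonal on long branches. -/
theorem IsToupie.lie_diagCocycles_radCocycles {T : Set (Path o w)} (hT : ∀ b ∈ T, 2 ≤ b.length)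
    {f z : Cocycles1 k (QuotAlgebra I)} (hf : f ∈ diagCocycles I T)
    (hz : z ∈ radCocycles I o w) : ⁅f, z⁆ ∈ radCocycles I o w := by
  refine ⟨(relCocycles I).lie_mem hf.1 hz.1, fun e he => hQ.lie_apply_arrow hf.1 hz.1 he,
    fun u => ?_⟩
  rw [lie_apply, hQ.diagCocycles_apply_arrow hT hf, map_zero, sub_zero]
  exact hQ.relCocycles_map_longCorner hf.1 (hz.2.2 u)

section Matrix

variable {a : ℕ} {α : Fin a ≃ (o ⟶ w)} {M : Matrix (Fin a) (Fin a) k}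
  {f : Cocycles1 k (QuotAlgebra I)}

omit hQ [LinearOrder (Path o w)] in
theorem extends_matrixCochain_apply (hf : Extends I (matrixCochain I α M) f) (p : Fin a) :
    f.1 (pathClass I (α p).toPath) = ∑ q, M q p • pathClass I (α q).toPath :=
  (hf.2 ⟨o, w, α p⟩).trans (matrixCochain_apply α M p)

omit hQ [LinearOrder (Path o w)] in
theorem extends_matrixCochain_apply_of_ne (hf : Extends I (matrixCochain I α M) f) {e : Arrow V}
    (he : ¬ (e.1 = o ∧ e.2.1 = w)) : f.1 (pathClass I e.2.2.toPath) = 0 :=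
  (hf.2 e).trans (matrixCochain_of_ne α M he)

omit [LinearOrder (Path o w)] in
theorem IsToupie.lie_matrix_diagCocycles (hf : Extends I (matrixCochain I α M) f)
    {T : Set (Path o w)} (hT : ∀ b ∈ T, 2 ≤ b.length) {g : Cocycles1 k (QuotAlgebra I)}
    (hg : g ∈ diagCocycles I T) : ⁅f, g⁆ = 0 := by
  refine hQ.lie_eq_zero hf.1 hg.1 fun u => ?_
  obtain ⟨p, rfl⟩ := α.surjective u
  rw [hQ.diagCocycles_apply_arrow hT hg, map_zero, extends_matrixCochain_apply hf, map_sum]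
  simp [hQ.diagCocycles_apply_arrow hT hg]

/-- `f` kills long branches, so the bracket sends `u` to `-z (f u)`, where `f u` is again a
combination of arrows from `o` to `w`. -/
theorem IsToupie.lie_matrix_radCocycles (hf : Extends I (matrixCochain I α M) f)
    {z : Cocycles1 k (QuotAlgebra I)} (hz : z ∈ radCocycles I o w) :
    ⁅f, z⁆ ∈ radCocycles I o w := by
  refine ⟨(relCocycles I).lie_mem hf.1 hz.1, fun e he => hQ.lie_apply_arrow hf.1 hz.1 he,
    fun u => ?_⟩
  obtain ⟨p, rfl⟩ := α.surjective u
  rw [lie_apply, hQ.apply_longCorner_eq_zero hf.1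
    (fun e he => extends_matrixCochain_apply_of_ne hf he) (hz.2.2 _), zero_sub,
    extends_matrixCochain_apply hf, map_sum]
  refine neg_mem (sum_mem fun q _ => ?_)
  rw [map_smul]
  exact Submodule.smul_mem _ _ (hz.2.2 _)

omit hQ [LinearOrder (Path o w)] in
theorem extends_matrixCochain_iff :
    Extends I (matrixCochain I α M) f ↔ f ∈ relCocycles I ∧
      (∀ e : Arrow V, ¬ (e.1 = o ∧ e.2.1 = w) → f.1 (pathClass I e.2.2.toPath) = 0) ∧
      ∀ p, f.1 (pathClass I (α p).toPath) = ∑ q, M q p • pathClass I (α q).toPath := by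
  refine ⟨fun h => ⟨h.1, fun e he => extends_matrixCochain_apply_of_ne h he,
    extends_matrixCochain_apply h⟩, fun h => ⟨h.1, fun e => ?_⟩⟩
  by_cases he : e.1 = o ∧ e.2.1 = w
  · obtain ⟨x, y, u⟩ := e
    obtain ⟨rfl, rfl⟩ := he
    obtain ⟨p, hp⟩ := α.surjective u
    have h' := (h.2.2 p).trans (matrixCochain_apply α M p).symm
    rwa [hp] at h'
  · rw [matrixCochain_of_ne α M he]
    exact h.2.1 e he

end Matrix

end Brackets

end Subspaces

/-! ### The action of `sl_a` -/

section MatrixClass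

variable {k : Type*} {V : Type*} [Quiver V] [Field k] [Fintype V]
variable {I : Ideal (PathAlgebra k V)} [I.IsTwoSided] {o w : V}

/-- Matrices of trace `0` as classes in `HH¹(A)`. -/
def matrixClass (hQ : IsToupie o w) (hI : IsAdmissible I) {a : ℕ} (α : Fin a ≃ (o ⟶ w)) :
    LieAlgebra.SpecialLinear.sl (Fin a) k →ₗ⁅k⁆ HH1 k (QuotAlgebra I) where
  toFun M := arrowClass I (matrixCochain I α M.1)
  map_add' M N := by
    obtain ⟨f, hf⟩ := hQ.isArrowCocycle_matrixCochain hI α M.1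
    obtain ⟨g, hg⟩ := hQ.isArrowCocycle_matrixCochain hI α N.1
    rw [arrowClass_eq hf, arrowClass_eq hg, ← map_add]
    refine arrowClass_eq (extends_matrixCochain_iff.2 ⟨add_mem hf.1 hg.1, fun e he => ?_,
      fun p => ?_⟩)
    · rw [add_apply, extends_matrixCochain_apply_of_ne hf he,
        extends_matrixCochain_apply_of_ne hg he, add_zero]
    · rw [add_apply, extends_matrixCochain_apply hf, extends_matrixCochain_apply hg,
        ← Finset.sum_add_distrib]
      exact Finset.sum_congr rfl fun q _ => (add_smul _ _ _).symm
  map_smul' c M := by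
    obtain ⟨f, hf⟩ := hQ.isArrowCocycle_matrixCochain hI α M.1
    rw [arrowClass_eq hf, RingHom.id_apply, ← map_smul]
    refine arrowClass_eq (extends_matrixCochain_iff.2 ⟨(relCocycles I).smul_mem c hf.1,
      fun e he => ?_, fun p => ?_⟩)
    · change c • f.1 _ = 0
      rw [extends_matrixCochain_apply_of_ne hf he, smul_zero]
    · change c • f.1 _ = _
      rw [extends_matrixCochain_apply hf, Finset.smul_sum]
      exact Finset.sum_congr rfl fun q _ => (mul_smul _ _ _).symm
  map_lie' {M N} := by
    obtain ⟨f, hf⟩ := hQ.isArrowCocycle_matrixCochain hI α M.1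
    obtain ⟨g, hg⟩ := hQ.isArrowCocycle_matrixCochain hI α N.1
    rw [arrowClass_eq hf, arrowClass_eq hg, ← LieHom.map_lie]
    refine arrowClass_eq (extends_matrixCochain_iff.2 ⟨(relCocycles I).lie_mem hf.1 hg.1,
      fun e he => hQ.lie_apply_arrow hf.1 hg.1 he, fun p => ?_⟩)
    -- Column `p` of the matrix is the image of `α p`, so composition of cocycles on these arrows is
    -- the matrix product in the same order.
    have key : ∀ {f g : Cocycles1 k (QuotAlgebra I)} {M N : Matrix (Fin a) (Fin a) k},
        Extends I (matrixCochain I α M) f → Extends I (matrixCochain I α N) g →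
        f.1 (g.1 (pathClass I (α p).toPath)) = ∑ q, (M * N) q p • pathClass I (α q).toPath := by
      intro f g M N hf hg
      rw [extends_matrixCochain_apply hg, map_sum]
      simp only [map_smul, extends_matrixCochain_apply hf, Finset.smul_sum, smul_smul,
        Matrix.mul_apply, Finset.sum_smul]
      rw [Finset.sum_comm]
      simp only [mul_comm]
    rw [lie_apply, key hf hg, key hg hf, ← Finset.sum_sub_distrib,
      LieAlgebra.SpecialLinear.sl_bracket]
    exact Finset.sum_congr rfl fun q _ => (sub_smul _ _ _).symm

end MatrixClass

end Toupie

end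

noncomputable section

namespace Toupie

open Quiver

theorem toPath_injective {V : Type*} [Quiver V] {x y : V} {u v : x ⟶ y}
    (h : u.toPath = v.toPath) : u = v := by
  have h' := congrArg firstArrow h
  simpa [Hom.toPath, firstArrow] using h'

theorem exists_eq_toPath {V : Type*} [Quiver V] {x y : V} {p : Path x y} (hp : p.length = 1) :
    ∃ u : x ⟶ y, p = u.toPath := by
  obtain ⟨z, e, r, rfl⟩ := exists_eq_toPath_comp p (by omega)
  have hr : r.length = 0 := by simpa using hp
  obtain rfl := Path.eq_of_length_zero r hr
  rw [Path.eq_nil_of_length_zero r hr]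
  exact ⟨e, rfl⟩

/-! ### A basis of `e_o A e_w`: arrows and long irreducible branches -/

section Basis

variable {k : Type*} {V : Type*} [Quiver V] [Field k] [Fintype V]
variable {I : Ideal (PathAlgebra k V)} [I.IsTwoSided] {o w : V}

theorem mem_branchRelations_iff_linearCombination {x y : V} {v : Path x y →₀ k} :
    v ∈ branchRelations I x y ↔
      Finsupp.linearCombination k (fun p : Path x y => pathClass I p) v = 0 :=
  mem_branchRelations_iff_sum

theorem IsAdmissible.pathClass_arrow_ne_zero (hI : IsAdmissible I) {x y : V} (e : x ⟶ y) :
    pathClass I e.toPath ≠ 0 := fun h => by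
  have h' : Finsupp.single e.toPath (1 : k) ∈ branchRelations I x y := by
    rw [mem_branchRelations_iff_linearCombination, Finsupp.linearCombination_single, one_smul]
    exact h
  have := hI.two_le_length_of_mem h' (p := e.toPath) (by simp)
  simp at this

theorem sum_smul_apply {ι : Type*} (s : Finset ι) (c : ι → k)
    (D : ι → Cocycles1 k (QuotAlgebra I)) (x : QuotAlgebra I) :
    (∑ i ∈ s, c i • D i).1 x = ∑ i ∈ s, c i • (D i).1 x :=
  (map_sum ((LinearMap.applyₗ x).comp (Cocycles1 k (QuotAlgebra I)).toSubmodule.subtype) _ _).trans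
    rfl

variable [LinearOrder (Path o w)]

omit [I.IsTwoSided] in
theorem IsLeadingBranch.two_le_length (hI : IsAdmissible I) {b : Path o w}
    (hb : IsLeadingBranch I b) : 2 ≤ b.length := by
  obtain ⟨v, hv, hvb, -⟩ := hb
  exact hI.two_le_length_of_mem hv hvb

variable [Finite (Path o w)]

/-- The reduction of a long branch involves long branches only, since relations are supported in
length at least two. -/
theorem pathClass_mem_longCorner (hI : IsAdmissible I) {b : Path o w} (hb : 2 ≤ b.length) :
    pathClass I b ∈ longCorner I o w := by
  obtain ⟨u, hu, hmem⟩ := exists_reduction (I := I) b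
  have h := mem_branchRelations_iff_linearCombination.1 hmem
  rw [map_sub, Finsupp.linearCombination_single, one_smul, sub_eq_zero] at h
  rw [h, Finsupp.linearCombination_apply]
  refine sum_mem fun c hc => Submodule.smul_mem _ _ (Submodule.subset_span ⟨⟨c, ?_, ?_⟩, rfl⟩)
  · by_cases hcb : c = b
    · rwa [hcb]
    · refine hI.two_le_length_of_mem hmem (p := c) ?_
      rw [Finsupp.sub_apply, Finsupp.single_eq_of_ne hcb, zero_sub]
      exact neg_ne_zero.2 (Finsupp.mem_support_iff.1 hc)
  · exact fun hl => Finsupp.mem_support_iff.1 hc (hu c hl)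

theorem exists_of_mem_corner (hI : IsAdmissible I) (how : o ≠ w) {a : ℕ} (α : Fin a ≃ (o ⟶ w))
    {x : QuotAlgebra I} (hx : x ∈ corner I o w) :
    ∃ m : Fin a → k, x - ∑ q, m q • pathClass I (α q).toPath ∈ longCorner I o w := by
  refine corner_induction (P := fun x => ∃ m : Fin a → k,
    x - ∑ q, m q • pathClass I (α q).toPath ∈ longCorner I o w) ⟨0, by simp⟩ ?_ ?_ (fun b => ?_) hx
  · rintro x y ⟨m, hm⟩ ⟨n, hn⟩
    refine ⟨m + n, ?_⟩
    simp only [Pi.add_apply, add_smul, Finset.sum_add_distrib, add_sub_add_comm]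
    exact add_mem hm hn
  · rintro c x ⟨m, hm⟩
    refine ⟨c • m, ?_⟩
    simp only [Pi.smul_apply, smul_assoc, ← Finset.smul_sum, ← smul_sub]
    exact Submodule.smul_mem _ c hm
  · have hb : b.length ≠ 0 := fun h => how (Path.eq_of_length_zero b h)
    obtain h | h : b.length = 1 ∨ 2 ≤ b.length := by omega
    · obtain ⟨u, rfl⟩ := exists_eq_toPath h
      obtain ⟨p, rfl⟩ := α.surjective u
      refine ⟨Pi.single p 1, ?_⟩
      rw [Finset.sum_eq_single p, Pi.single_eq_same, one_smul, sub_self]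
      · exact zero_mem _
      · intro q _ hq
        rw [Pi.single_eq_of_ne hq, zero_smul]
      · simp
    · exact ⟨0, by simpa using pathClass_mem_longCorner hI h⟩

/-- Independence of the arrows from the long branches: an equality of both sides is a relation
between irreducible branches (arrows are never leading), hence trivial. -/
theorem eq_zero_of_sum_mem_longCorner (hI : IsAdmissible I) {a : ℕ} (α : Fin a ≃ (o ⟶ w))
    {m : Fin a → k} (h : ∑ q, m q • pathClass I (α q).toPath ∈ longCorner I o w) : m = 0 := by
  have := Fintype.ofFinite (LongIrreducible I o w)
  obtain ⟨z, hz⟩ := (Submodule.mem_span_range_iff_exists_fun k).1 h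
  let v : Path o w →₀ k :=
    ∑ q, Finsupp.single (α q).toPath (m q) - ∑ s : LongIrreducible I o w, Finsupp.single s.1 (z s)
  have hv : v ∈ branchRelations I o w := by
    rw [mem_branchRelations_iff_linearCombination, map_sub, map_sum, map_sum]
    simp only [Finsupp.linearCombination_single]
    rw [hz, sub_self]
  have hs : ∀ c : Path o w, (∀ s : LongIrreducible I o w, c ≠ s.1) →
      v c = ∑ q, Finsupp.single (α q).toPath (m q) c := fun c hc => by
    rw [Finsupp.sub_apply, Finsupp.finsetSum_apply, Finsupp.finsetSum_apply,
      Finset.sum_eq_zero (s := Finset.univ) (f := fun s : LongIrreducible I o w =>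
        Finsupp.single s.1 (z s) c) fun s _ => Finsupp.single_eq_of_ne (hc s), sub_zero]
  have hv0 : v = 0 := branchRelations_eq_zero (I := I) hv fun c hc => by
    rw [hs c fun s h => s.2.2 (h ▸ hc)]
    refine Finset.sum_eq_zero fun q _ => Finsupp.single_eq_of_ne fun h => ?_
    have := hc.two_le_length hI
    rw [h] at this
    simp at this
  funext p
  have hp := hs (α p).toPath fun s h => by
    have := s.2.1
    rw [← h] at this
    simp at this
  rw [hv0, Finset.sum_eq_single p, Finsupp.single_eq_same] at hp
  · exact hp.symm
  · intro q _ hq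
    exact Finsupp.single_eq_of_ne fun h => hq (α.injective (toPath_injective h)).symm
  · simp

theorem radCocycles_le_span [Finite (o ⟶ w)]
    {D : (o ⟶ w) × LongIrreducible I o w → Cocycles1 k (QuotAlgebra I)}
    (hD : ∀ us, Extends I (zCochain I us.1 us.2.1) (D us)) :
    radCocycles I o w ≤ Submodule.span k (Set.range D) := by
  intro f hf
  have := Fintype.ofFinite (LongIrreducible I o w)
  have := Fintype.ofFinite (o ⟶ w)
  have h : ∀ u : o ⟶ w, ∃ z : LongIrreducible I o w → k,
      ∑ s, z s • pathClass I s.1 = f.1 (pathClass I u.toPath) := fun u =>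
    (Submodule.mem_span_range_iff_exists_fun k).1 (hf.2.2 u)
  choose z hz using h
  have hrel : ∑ us : (o ⟶ w) × LongIrreducible I o w, z us.1 us.2 • D us ∈ relCocycles I :=
    sum_mem fun us _ => (relCocycles I).smul_mem _ (hD us).1
  have hf' : f = ∑ us : (o ⟶ w) × LongIrreducible I o w, z us.1 us.2 • D us := by
    refine relCocycles_ext hf.1 hrel fun e => ?_
    rw [sum_smul_apply]
    simp only [(hD _).2]
    by_cases he : e.1 = o ∧ e.2.1 = w
    · obtain ⟨x, y, u⟩ := e
      obtain ⟨rfl, rfl⟩ := he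
      dsimp only
      rw [← hz u, Fintype.sum_prod_type, Finset.sum_eq_single u]
      · exact Finset.sum_congr rfl fun s _ => by rw [zCochain_self]
      · intro u' _ hu'
        refine Finset.sum_eq_zero fun s _ => ?_
        rw [zCochain_of_ne, smul_zero]
        intro h
        exact hu' (by simpa using h.symm)
      · simp
    · rw [hf.2.1 e he]
      refine (Finset.sum_eq_zero fun us _ => ?_).symm
      rw [zCochain_of_ne, smul_zero]
      rintro rfl
      exact he ⟨rfl, rfl⟩
  rw [hf']
  exact sum_mem fun us _ => Submodule.smul_mem _ _ (Submodule.subset_span ⟨us, rfl⟩)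

omit [Finite (Path o w)] in
theorem zCochain_mem_radCocycles {u : o ⟶ w} {s : LongIrreducible I o w}
    {f : Cocycles1 k (QuotAlgebra I)} (hf : Extends I (zCochain I u s.1) f) :
    f ∈ radCocycles I o w := by
  refine ⟨hf.1, fun e he => (hf.2 e).trans (zCochain_of_ne ?_ _), fun u' => ?_⟩
  · rintro rfl
    exact he ⟨rfl, rfl⟩
  · rw [hf.2 ⟨o, w, u'⟩]
    by_cases h : (⟨o, w, u'⟩ : Arrow V) = ⟨o, w, u⟩
    · rw [h, zCochain_self]
      exact Submodule.subset_span ⟨s, rfl⟩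
    · rw [zCochain_of_ne h]
      exact zero_mem _

omit [LinearOrder (Path o w)] [Finite (Path o w)] in
theorem diagCochain_mem_diagCocycles (hQ : IsToupie o w) {μ : Path o w → k} {T : Set (Path o w)}
    (hμ : ∀ b ∉ T, μ b = 0) {f : Cocycles1 k (QuotAlgebra I)}
    (hf : Extends I (diagCochain I μ) f) : f ∈ diagCocycles I T := by
  refine ⟨hf.1, fun e he => (hf.2 e).trans ?_⟩
  rw [diagCochain]
  by_cases h : ∃ b : Path o w, firstArrow b = some e
  · obtain ⟨b, hb⟩ := h
    rw [hQ.firstScalar_eq μ hb, hμ b fun hT => he b hT hb, zero_smul]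
  · rw [firstScalar_of_forall_ne μ fun b hb => h ⟨b, hb⟩, zero_smul]

end Basis

end Toupie

end

noncomputable section

namespace Toupie

open Quiver

/-! ### Uniqueness and existence of the decomposition -/

section Decomposition

variable {k : Type*} {V : Type*} [Quiver V] [Field k] [CharZero k] [Fintype V]
variable {I : Ideal (PathAlgebra k V)} [I.IsTwoSided] {o w : V}
variable [LinearOrder (Path o w)] [Finite (Path o w)]

variable (I o w) in
/-- The set of branches that contain a monomial relation. -/
def monomialSet : Set (Path o w) := {b | ContainsMonomialRelation I b}

variable (I o w) in
/-- The set of branches that are vertices of `Q_ρ`. -/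
def rhoSet : Set (Path o w) := {b | 2 ≤ b.length ∧ ¬ ContainsMonomialRelation I b}

omit [CharZero k] [LinearOrder (Path o w)] [Finite (Path o w)] in
theorem two_le_length_of_mem_monomialSet (hI : IsAdmissible I) {b : Path o w}
    (hb : b ∈ monomialSet I o w) : 2 ≤ b.length :=
  hI.two_le_length_of_mem (ContainsMonomialRelation.single_mem hb) (by simp)

/-- A coboundary multiplies each arrow from `x` to `y` by `d y - d x`. On the arrows from `o` to `w`
this forces `M` to be scalar, so trace zero gives `d w = d o`; the arrows not starting at `o` force
`d` to be constant along the rest of each branch. Hence the coboundary vanishes on first arrows too.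
-/
theorem IsToupie.eq_zero_of_mkHom_eq_zero (hQ : IsToupie o w) (hI : IsAdmissible I) {a : ℕ}
    (ha : 0 < a) (α : Fin a ≃ (o ⟶ w)) {M : Matrix (Fin a) (Fin a) k} (hM : M.trace = 0)
    {y f t z : Cocycles1 k (QuotAlgebra I)} (hy : y ∈ diagCocycles I (monomialSet I o w))
    (hf : Extends I (matrixCochain I α M) f) (ht : t ∈ diagCocycles I (rhoSet I o w))
    (hz : z ∈ radCocycles I o w) (h : HH1.mkHom k _ (y + (f + (t + z))) = 0) :
    y = 0 ∧ M = 0 ∧ t = 0 ∧ z = 0 := by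
  have hmon : ∀ b ∈ monomialSet I o w, 2 ≤ b.length := fun b =>
    two_le_length_of_mem_monomialSet hI
  have hrho : ∀ b ∈ rhoSet I o w, 2 ≤ b.length := fun b hb => hb.1
  obtain ⟨d, hd⟩ := hQ.exists_of_mkHom_eq_zero
    (add_mem hy.1 (add_mem hf.1 (add_mem ht.1 hz.1))) h
  simp only [add_apply] at hd
  -- Comparison modulo long branches, which absorb `z`: `M` is `d w - d o` times the identity.
  have hαp : ∀ p, M.col p - Pi.single p (d w - d o) = 0 := fun p => by
    refine eq_zero_of_sum_mem_longCorner hI α ?_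
    have hp := hd (α p)
    rw [hQ.diagCocycles_apply_arrow hmon hy, hQ.diagCocycles_apply_arrow hrho ht, zero_add,
      zero_add, extends_matrixCochain_apply hf] at hp
    have hs : ∑ q, (M.col p - Pi.single p (d w - d o) : Fin a → k) q • pathClass I (α q).toPath =
        -z.1 (pathClass I (α p).toPath) := by
      simp only [Pi.sub_apply, sub_smul, Finset.sum_sub_distrib]
      rw [Finset.sum_eq_single (f := fun q => (Pi.single p (d w - d o) : Fin a → k) q •
        pathClass I (α q).toPath) p, Pi.single_eq_same, ← hp]
      · simp [Matrix.col]
      · intro q _ hq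
        rw [Pi.single_eq_of_ne hq, zero_smul]
      · simp
    rw [hs]
    exact neg_mem (hz.2.2 _)
  have hMqp : ∀ q p, M q p = (Pi.single p (d w - d o) : Fin a → k) q := fun q p =>
    sub_eq_zero.1 (congrFun (hαp p) q)
  have hδ : d w - d o = 0 := by
    have htr : (a : k) * (d w - d o) = 0 := by
      rw [← hM]
      simp [Matrix.trace, hMqp, mul_sub]
    exact (mul_eq_zero.1 htr).resolve_left (Nat.cast_ne_zero.2 ha.ne')
  have hM0 : M = 0 := by
    ext q p
    rw [hMqp, hδ, Pi.single_zero]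
    rfl
  have hf0 : ∀ u : o ⟶ w, f.1 (pathClass I u.toPath) = 0 := fun u => by
    obtain ⟨p, rfl⟩ := α.surjective u
    rw [extends_matrixCochain_apply hf, hM0]
    simp
  have hz0 : z = 0 := by
    refine relCocycles_ext hz.1 (zero_mem _) fun e => ?_
    change _ = 0
    by_cases he : e.1 = o ∧ e.2.1 = w
    · obtain ⟨x, y, u⟩ := e
      obtain ⟨rfl, rfl⟩ := he
      have := hd u
      rwa [hQ.diagCocycles_apply_arrow hmon hy, hQ.diagCocycles_apply_arrow hrho ht, hδ, hf0,
        zero_add, zero_add, zero_add, zero_smul] at this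
    · exact hz.2.1 e he
  have hd0 : ∀ {x y : V} (p : Path x y), x ≠ o → d y = d x := fun {x y} p hx => by
    induction p with
    | nil => rfl
    | @cons y z p e ih =>
      have he : y ≠ o := by
        cases p with
        | nil => exact hx
        | cons p f => exact hQ.target_ne_source f
      have := hd e
      rw [diagCocycles_apply_of_source_ne hy (e := ⟨y, z, e⟩) he,
        diagCocycles_apply_of_source_ne ht (e := ⟨y, z, e⟩) he,
        extends_matrixCochain_apply_of_ne hf (e := ⟨y, z, e⟩) fun h => he h.1,
        hz.2.1 ⟨y, z, e⟩ fun h => he h.1, add_zero, add_zero, add_zero] at this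
      rw [← ih, ← sub_eq_zero]
      exact (smul_eq_zero.1 this.symm).resolve_right (hI.pathClass_arrow_ne_zero e)
  have hyt : ∀ (e : Arrow V) (b : Path o w), 2 ≤ b.length → firstArrow b = some e →
      y.1 (pathClass I e.2.2.toPath) + t.1 (pathClass I e.2.2.toPath) = 0 := fun e b hb he => by
    obtain ⟨x, g, r, rfl, rfl⟩ := exists_of_firstArrow_eq he
    have hne : ¬ (o = o ∧ x = w) := by
      rintro ⟨-, rfl⟩
      exact hQ.firstArrow_ne hb g he
    have := hd g
    rwa [extends_matrixCochain_apply_of_ne hf (e := ⟨o, x, g⟩) hne, hz.2.1 ⟨o, x, g⟩ hne,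
      ← hd0 r (hQ.target_ne_source g), hδ, zero_smul, add_zero, zero_add] at this
  refine ⟨?_, hM0, ?_, hz0⟩
  · refine relCocycles_ext hy.1 (zero_mem _) fun e => ?_
    change _ = 0
    by_cases he : ∃ b ∈ monomialSet I o w, firstArrow b = some e
    -- The cocycles `y` and `t` live on first arrows of disjoint sets of branches, so their sum
    -- vanishes only if each does.
    · obtain ⟨b, hb, he⟩ := he
      have := hyt e b (hmon b hb) he
      rwa [ht.2 e, add_zero] at this
      intro c hc h
      rw [hQ.eq_of_firstArrow h he] at hc
      exact hc.2 hb
    · exact hy.2 e fun b hb h => he ⟨b, hb, h⟩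
  · refine relCocycles_ext ht.1 (zero_mem _) fun e => ?_
    change _ = 0
    by_cases he : ∃ b ∈ rhoSet I o w, firstArrow b = some e
    · obtain ⟨b, hb, he⟩ := he
      have := hyt e b hb.1 he
      rwa [hy.2 e, zero_add] at this
      intro c hc h
      rw [hQ.eq_of_firstArrow h he] at hc
      exact hb.2 hc
    · exact ht.2 e fun b hb h => he ⟨b, hb, h⟩

/-- Any class in `HH¹(A)` has a representative that is `0` on the arrows that do not start at the
source, and whose matrix on the arrows from the source to the sink has trace `0`. -/
theorem IsToupie.exists_normalized (hQ : IsToupie o w) (hI : IsAdmissible I) (how : o ≠ w) {a : ℕ}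
    (ha : 0 < a) (α : Fin a ≃ (o ⟶ w)) (x : HH1 k (QuotAlgebra I)) :
    ∃ F ∈ relCocycles I, HH1.mkHom k _ F = x ∧
      (∀ e : Arrow V, e.1 ≠ o → F.1 (pathClass I e.2.2.toPath) = 0) ∧
      ∃ M : Matrix (Fin a) (Fin a) k, M.trace = 0 ∧ ∀ p, F.1 (pathClass I (α p).toPath) -
        ∑ q, M q p • pathClass I (α q).toPath ∈ longCorner I o w := by
  classical
  obtain ⟨G, hG, rfl⟩ := exists_relCocycles_mkHom_eq x
  obtain ⟨c, hc⟩ := hQ.exists_arrow_scalars hG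
  have hm : ∀ p, ∃ m : Fin a → k, G.1 (pathClass I (α p).toPath) -
      ∑ q, m q • pathClass I (α q).toPath ∈ longCorner I o w := fun p =>
    exists_of_mem_corner hI how α (relCocycles_map_mem_corner hG (pathClass_mem_corner _))
  choose m hm using hm
  let N : Matrix (Fin a) (Fin a) k := Matrix.of fun q p => m p q
  obtain ⟨r⟩ : Nonempty (∀ x, Path x w) := ⟨fun x => (hQ.nonempty_path_sink x).some⟩
  -- Off `o` the potential is minus the weight of the unique path to `w`, so `d y - d x` equals `c
  -- e` on every arrow `e` from `x ≠ o` to `y`. As `d w = 0`, the value at `o` subtracts `N.trace /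
  -- a` times the identity from `N`.
  let d : V → k := fun x => if x = o then -(N.trace / a) else -pathWeight c (r x)
  have hdo : d o = -(N.trace / a) := if_pos rfl
  have hdx : ∀ x, x ≠ o → d x = -pathWeight c (r x) := fun x hx => if_neg hx
  have hdw : d w = 0 := by rw [hdx w how.symm, hQ.eq_nil (r w), pathWeight, neg_zero]
  obtain ⟨i, hi, hi0, hie⟩ := exists_inner_relCocycle (I := I) d
  refine ⟨G - i, sub_mem hG hi, by rw [map_sub, hi0, sub_zero], fun e he => ?_,
    N - (N.trace / a) • 1, ?_, fun p => ?_⟩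
  · obtain ⟨x, y, e⟩ := e
    dsimp only at he ⊢
    have hy := hQ.target_ne_source e
    rw [sub_apply, hc ⟨x, y, e⟩ fun h => he h.1, hie, hdx x he, hdx y hy,
      (hQ.subsingleton_path_of_ne_source he).elim (r x) (e.toPath.comp (r y)), pathWeight_comp,
      pathWeight_toPath, ← sub_smul]
    convert zero_smul k _
    ring
  · rw [Matrix.trace_sub, Matrix.trace_smul, Matrix.trace_one, Fintype.card_fin, smul_eq_mul,
      div_mul_cancel₀ _ (Nat.cast_ne_zero.2 ha.ne'), sub_self]
  · have hs : ∑ q, (N - (N.trace / a) • (1 : Matrix (Fin a) (Fin a) k)) q p •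
        pathClass I (α q).toPath = ∑ q, m p q • pathClass I (α q).toPath -
          (N.trace / a) • pathClass I (α p).toPath := by
      simp only [Matrix.sub_apply, sub_smul, Finset.sum_sub_distrib]
      congr 1
      rw [Finset.sum_eq_single p]
      · simp
      · intro q _ hq
        simp [hq]
      · simp
    rw [hs, sub_apply, hie, hdw, hdo, zero_sub, neg_neg, sub_sub_sub_cancel_right]
    exact hm p

/-- For a normalized representative, the scalar on the first arrow of a long branch is the weight
`μ` of the branch, and `μ` is constant on components of `Q_ρ`. So `y` and `t` can be read off from
`μ`, and what is left after removing them and the matrix part lies in `radCocycles`. -/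
theorem IsToupie.exists_decomposition (hQ : IsToupie o w) (hI : IsAdmissible I) (how : o ≠ w)
    {a : ℕ} (ha : 0 < a) (α : Fin a ≃ (o ⟶ w))
    {T : (rhoGraph I o w).ConnectedComponent → Cocycles1 k (QuotAlgebra I)}
    (hT : ∀ h, Extends I (tCochain I h) (T h))
    {Y : MonomialBranch I o w → Cocycles1 k (QuotAlgebra I)}
    (hY : ∀ i, Extends I (firstCochain I i.1) (Y i)) (x : HH1 k (QuotAlgebra I)) :
    ∃ y ∈ Submodule.span k (Set.range Y), ∃ M : Matrix (Fin a) (Fin a) k, M.trace = 0 ∧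
      ∃ f, Extends I (matrixCochain I α M) f ∧ ∃ t ∈ Submodule.span k (Set.range T),
        ∃ z ∈ radCocycles I o w, x = HH1.mkHom k _ (y + (f + (t + z))) := by
  classical
  obtain ⟨F, hF, rfl, hF0, M, hM, hFM⟩ := hQ.exists_normalized hI how ha α x
  obtain ⟨f, hf⟩ := hQ.isArrowCocycle_matrixCochain hI α M
  obtain ⟨c', hc'⟩ := hQ.exists_arrow_scalars hF
  let c : Arrow V → k := fun e => if e.1 = o then c' e else 0
  have hc0 : ∀ e : Arrow V, e.1 ≠ o → c e = 0 := fun e he => if_neg he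
  have hc : ∀ e : Arrow V, ¬ (e.1 = o ∧ e.2.1 = w) →
      F.1 (pathClass I e.2.2.toPath) = c e • pathClass I e.2.2.toPath := fun e he => by
    by_cases heo : e.1 = o
    · rw [hc' e he]
      simp only [c, if_pos heo]
    · rw [hF0 e heo, hc0 e heo, zero_smul]
  let μ : Path o w → k := pathWeight c
  have hμ : ∀ v ∈ branchRelations I o w, μ • v ∈ branchRelations I o w := fun v hv =>
    hQ.weight_smul_mem hI hF hc hv
  have := Fintype.ofFinite (MonomialBranch I o w)
  have := Fintype.ofFinite (rhoGraph I o w).ConnectedComponent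
  let y : Cocycles1 k (QuotAlgebra I) := ∑ i, μ i.1 • Y i
  -- The representative `h.out` does not matter, by `eq_of_reachable`.
  let t : Cocycles1 k (QuotAlgebra I) := ∑ h : (rhoGraph I o w).ConnectedComponent,
    μ h.out.1 • T h
  have hYd : ∀ i, Extends I (diagCochain I (Pi.single i.1 1)) (Y i) := fun i => by
    rw [← hQ.firstCochain_eq I]
    exact hY i
  have hTd : ∀ h, Extends I (diagCochain I ((componentBranches h).indicator 1)) (T h) := fun h => by
    rw [← hQ.tCochain_eq I]
    exact hT h
  have hy : y ∈ diagCocycles I (monomialSet I o w) := sum_mem fun i _ =>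
    Submodule.smul_mem _ _ (diagCochain_mem_diagCocycles hQ (fun b hb => Pi.single_eq_of_ne
      (fun h : b = i.1 => hb (by rw [h]; exact i.2)) 1) (hYd i))
  have ht : t ∈ diagCocycles I (rhoSet I o w) := sum_mem fun h _ =>
    Submodule.smul_mem _ _ (diagCochain_mem_diagCocycles hQ
      (fun b hb => Set.indicator_of_notMem (fun h' : b ∈ componentBranches h => hb (by
        obtain ⟨s, _, rfl⟩ := h'
        exact s.2)) 1) (hTd h))
  have hYe : ∀ (i : MonomialBranch I o w) {e : Arrow V} {b : Path o w}, firstArrow b = some e →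
      (Y i).1 (pathClass I e.2.2.toPath) =
        (Pi.single i.1 1 : Path o w → k) b • pathClass I e.2.2.toPath := fun i e b hb => by
    rw [(hYd i).2, diagCochain, hQ.firstScalar_eq _ hb]
  have hTe : ∀ (h : (rhoGraph I o w).ConnectedComponent) {e : Arrow V} {b : Path o w},
      firstArrow b = some e → (T h).1 (pathClass I e.2.2.toPath) =
        (componentBranches h).indicator (1 : Path o w → k) b • pathClass I e.2.2.toPath := by
    intro h e b hb
    rw [(hTd h).2, diagCochain, hQ.firstScalar_eq _ hb]
  have hyt : ∀ (e : Arrow V) (b : Path o w), 2 ≤ b.length → firstArrow b = some e →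
      y.1 (pathClass I e.2.2.toPath) + t.1 (pathClass I e.2.2.toPath) =
        μ b • pathClass I e.2.2.toPath := fun e b hb he => by
    by_cases hmon : ContainsMonomialRelation I b
    · rw [ht.2 e fun c hc h => hc.2 (by rwa [hQ.eq_of_firstArrow h he]), add_zero, sum_smul_apply,
        Finset.sum_eq_single (⟨b, hmon⟩ : MonomialBranch I o w), hYe _ he, Pi.single_eq_same,
        one_smul]
      · intro i _ hi
        rw [hYe i he, Pi.single_eq_of_ne fun h => hi (Subtype.ext h.symm), zero_smul, smul_zero]
      · simp
    · have hmem : ∀ h : (rhoGraph I o w).ConnectedComponent, b ∈ componentBranches h ↔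
          (rhoGraph I o w).connectedComponentMk ⟨b, hb, hmon⟩ = h := fun h =>
        Subtype.val_injective.mem_set_image (a := (⟨b, hb, hmon⟩ : RhoVertex I o w))
      rw [hy.2 e fun c hc h => hmon (hQ.eq_of_firstArrow h he ▸ hc), zero_add, sum_smul_apply,
        Finset.sum_eq_single ((rhoGraph I o w).connectedComponentMk ⟨b, hb, hmon⟩), hTe _ he,
        Set.indicator_of_mem ((hmem _).2 rfl), Pi.one_apply, one_smul,
        eq_of_reachable hμ (SimpleGraph.ConnectedComponent.exact (Quot.out_eq _))]
      · intro h _ hh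
        rw [hTe h he, Set.indicator_of_notMem fun h' => hh ((hmem h).1 h').symm, zero_smul,
          smul_zero]
      · simp
  have hz : F - (y + (f + t)) ∈ radCocycles I o w := by
    refine ⟨sub_mem hF (add_mem hy.1 (add_mem hf.1 ht.1)), fun e he => ?_, fun u => ?_⟩
    · rw [sub_apply, add_apply, add_apply, extends_matrixCochain_apply_of_ne hf he, zero_add]
      by_cases heo : e.1 = o
      · obtain ⟨x, z, e⟩ := e
        obtain rfl : x = o := heo
        obtain ⟨r⟩ := hQ.nonempty_path_sink z
        have hr : 0 < r.length := Nat.pos_of_ne_zero fun h =>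
          he ⟨rfl, Path.eq_of_length_zero r h⟩
        have hb := firstArrow_toPath_comp e r
        rw [hyt _ (e.toPath.comp r) (by rw [Path.length_comp, Path.length_toPath]; omega) hb,
          hc _ he, ← hQ.pathWeight_branch hc0 hb, sub_self]
      · rw [hF0 e heo, diagCocycles_apply_of_source_ne hy heo,
          diagCocycles_apply_of_source_ne ht heo, add_zero, sub_zero]
    · obtain ⟨p, rfl⟩ := α.surjective u
      rw [sub_apply, add_apply, add_apply, extends_matrixCochain_apply hf,
        hQ.diagCocycles_apply_arrow (fun b => two_le_length_of_mem_monomialSet hI) hy,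
        hQ.diagCocycles_apply_arrow (fun b hb => hb.1) ht, zero_add, add_zero]
      exact hFM p
  refine ⟨y, sum_mem fun i _ => Submodule.smul_mem _ _ (Submodule.subset_span ⟨i, rfl⟩), M, hM, f,
    hf, t, sum_mem fun h _ => Submodule.smul_mem _ _ (Submodule.subset_span ⟨h, rfl⟩), _, hz, ?_⟩
  congr 1
  abel

end Decomposition

end Toupie

end

noncomputable section

namespace Toupie

theorem span_range_mkHom {k : Type*} [CommRing k] {A : Type*} [Ring A] [Algebra k A] {ι : Type*}
    (D : ι → Cocycles1 k A) : Submodule.span k (Set.range fun i => HH1.mkHom k A (D i)) =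
      (Submodule.span k (Set.range D)).map (HH1.mkHom k A : Cocycles1 k A →ₗ[k] HH1 k A) := by
  rw [Submodule.map_span, ← Set.range_comp]
  rfl

end Toupie

end

/-! ### The main theorem -/

open Toupie LieAlgebra in
theorem mainTheorem1 {V : Type*} [Fintype V] [Quiver V] [∀ x y : V, Finite (x ⟶ y)] {o w : V}
    (hQ : IsToupie o w) (I : Ideal (PathAlgebra ℂ V)) [I.IsTwoSided] (hI : IsAdmissible I)
    [LinearOrder (Quiver.Path o w)] {a : ℕ} (ha : 0 < a) (α : Fin a ≃ (o ⟶ w)) :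
    -- all cochains below are cocycles
    (∀ h : (rhoGraph I o w).ConnectedComponent, IsArrowCocycle I (tCochain I h)) ∧
    (∀ (u : o ⟶ w) (s : LongIrreducible I o w), IsArrowCocycle I (zCochain I u s.1)) ∧
    (∀ i : MonomialBranch I o w, IsArrowCocycle I (firstCochain I i.1)) ∧
    (∀ M : SpecialLinear.sl (Fin a) ℂ, IsArrowCocycle I (matrixCochain I α M.1)) ∧
    ∃ (L : LieIdeal ℂ (HH1 ℂ (QuotAlgebra I)))
      (S₁ : LieSubalgebra ℂ (HH1 ℂ (QuotAlgebra I)))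
      (L₂ C : LieIdeal ℂ (HH1 ℂ (QuotAlgebra I))),
      L.toSubmodule = Submodule.span ℂ
        (Set.range (fun h : (rhoGraph I o w).ConnectedComponent => arrowClass I (tCochain I h)) ∪
          Set.range (fun us : (o ⟶ w) × LongIrreducible I o w =>
            arrowClass I (zCochain I us.1 us.2.1))) ∧
      S₁.toSubmodule = Submodule.span ℂ
        (Set.range fun h : (rhoGraph I o w).ConnectedComponent => arrowClass I (tCochain I h)) ∧
      L₂.toSubmodule = Submodule.span ℂ
        (Set.range fun us : (o ⟶ w) × LongIrreducible I o w =>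
          arrowClass I (zCochain I us.1 us.2.1)) ∧
      C.toSubmodule = Submodule.span ℂ
        (Set.range fun i : MonomialBranch I o w => arrowClass I (firstCochain I i.1)) ∧
      IsSolvable L ∧ IsLieAbelian S₁ ∧ IsLieAbelian L₂ ∧ IsLieAbelian C ∧
      ∃ θ : S₁ →ₗ⁅ℂ⁆ LieDerivation ℂ L₂ L₂,
        -- `L = S₁ ⋉ L₂`
        (∃ Ψ : (L₂ ⋊⁅θ⁆ S₁) ≃ₗ⁅ℂ⁆ L, ∀ (z : L₂) (t : S₁),
          (Ψ ⟨z, t⟩ : HH1 ℂ (QuotAlgebra I)) = t.1 + z.1) ∧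
        -- `HH¹(A) ≅ ⟨C''₁⟩ ⊕ sl_a(ℂ) ⋉ (S₁ ⋉ L₂)`
        ∃ ψ : SpecialLinear.sl (Fin a) ℂ →ₗ⁅ℂ⁆ LieDerivation ℂ (L₂ ⋊⁅θ⁆ S₁) (L₂ ⋊⁅θ⁆ S₁),
          ∃ Φ : (C × ((L₂ ⋊⁅θ⁆ S₁) ⋊⁅ψ⁆ SpecialLinear.sl (Fin a) ℂ)) ≃ₗ⁅ℂ⁆
              HH1 ℂ (QuotAlgebra I),
            ∀ (y : C) (z : L₂) (t : S₁) (M : SpecialLinear.sl (Fin a) ℂ),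
              Φ (y, ⟨⟨z, t⟩, M⟩) = y.1 + (arrowClass I (matrixCochain I α M.1) + (t.1 + z.1)) := by
  have how : o ≠ w := hQ.source_ne_sink (α ⟨0, ha⟩)
  have := hQ.finite_branch how
  have := Finite.of_equiv _ α
  have ht := fun h => hQ.isArrowCocycle_tCochain hI how h
  have hz := fun us : (o ⟶ w) × LongIrreducible I o w =>
    hQ.isArrowCocycle_zCochain hI us.1 us.2.1
  have hy := fun i : MonomialBranch I o w => hQ.isArrowCocycle_firstCochain hI how i.2
  refine ⟨ht, fun u s => hz (u, s), hy, fun M => hQ.isArrowCocycle_matrixCochain hI α M.1, ?_⟩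
  choose T hT using ht
  choose Z hZ using hz
  choose Y hY using hy
  simp only [Submodule.span_union, arrowClass_eq (hT _), arrowClass_eq (hZ _),
    arrowClass_eq (hY _), span_range_mkHom]
  have hTd : Submodule.span ℂ (Set.range T) ≤ diagCocycles I (rhoSet I o w) := by
    classical
    rw [Submodule.span_le]
    rintro _ ⟨h, rfl⟩
    refine diagCochain_mem_diagCocycles hQ (μ := (componentBranches h).indicator 1) (fun b hb =>
      Set.indicator_of_notMem (fun h' : b ∈ componentBranches h => hb ?_) 1) ?_
    · obtain ⟨s, _, rfl⟩ := h'
      exact s.2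
    · rw [← hQ.tCochain_eq I]
      exact hT h
  have hYd : Submodule.span ℂ (Set.range Y) ≤ diagCocycles I (monomialSet I o w) := by
    classical
    rw [Submodule.span_le]
    rintro _ ⟨i, rfl⟩
    refine diagCochain_mem_diagCocycles hQ (μ := Pi.single i.1 1) (fun b hb =>
      Pi.single_eq_of_ne (fun h : b = i.1 => hb (by rw [h]; exact i.2)) 1) ?_
    rw [← hQ.firstCochain_eq I]
    exact hY i
  -- Equality is needed here, because brackets and the remainder in the decomposition are only known
  -- to lie in `radCocycles`. For `T` and `Y` the inclusions suffice: their brackets vanish where a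
  -- span would have to be checked, and the decomposition yields elements of the spans.
  have hZd : Submodule.span ℂ (Set.range Z) = radCocycles I o w := by
    refine le_antisymm (Submodule.span_le.2 ?_) (radCocycles_le_span hZ)
    rintro _ ⟨us, rfl⟩
    exact zCochain_mem_radCocycles (hZ us)
  rw [hZd]
  have hrho : ∀ b ∈ rhoSet I o w, 2 ≤ b.length := fun b hb => hb.1
  have hmk : ∀ M : SpecialLinear.sl (Fin a) ℂ, ∃ f, Extends I (matrixCochain I α M.1) f ∧
      matrixClass hQ hI α M = HH1.mkHom ℂ _ f := fun M => by
    obtain ⟨f, hf⟩ := hQ.isArrowCocycle_matrixCochain hI α M.1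
    exact ⟨f, hf, arrowClass_eq hf⟩
  refine exists_semidirect_decomposition _ _ _ (matrixClass hQ hI α) ?_ ?_ ?_ ?_ ?_ ?_ ?_ ?_
  · rintro _ ⟨y, hy, rfl⟩ x
    obtain ⟨f, hf, rfl⟩ := exists_relCocycles_mkHom_eq x
    change ⁅HH1.mkHom ℂ _ f, HH1.mkHom ℂ _ y⁆ = 0
    rw [← LieHom.map_lie, hQ.lie_diagCocycles_of_monomial how (fun b hb => hb) hf (hYd hy),
      map_zero]
  · rintro _ ⟨t, ht, rfl⟩ _ ⟨t', ht', rfl⟩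
    change ⁅HH1.mkHom ℂ _ t, HH1.mkHom ℂ _ t'⁆ = 0
    rw [← LieHom.map_lie, hQ.lie_diagCocycles hrho (hTd ht) (hTd ht'), map_zero]
  · rintro _ ⟨z, hz, rfl⟩ _ ⟨z', hz', rfl⟩
    change ⁅HH1.mkHom ℂ _ z, HH1.mkHom ℂ _ z'⁆ = 0
    rw [← LieHom.map_lie, hQ.lie_radCocycles hz hz', map_zero]
  · rintro _ ⟨t, ht, rfl⟩ _ ⟨z, hz, rfl⟩
    exact ⟨⁅t, z⁆, hQ.lie_diagCocycles_radCocycles hrho (hTd ht) hz, LieHom.map_lie _ _ _⟩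
  · rintro M _ ⟨z, hz, rfl⟩
    obtain ⟨f, hf, h⟩ := hmk M
    rw [h]
    exact ⟨⁅f, z⁆, hQ.lie_matrix_radCocycles hf hz, LieHom.map_lie _ _ _⟩
  · rintro M _ ⟨t, ht, rfl⟩
    obtain ⟨f, hf, h⟩ := hmk M
    rw [h]
    change ⁅HH1.mkHom ℂ _ f, HH1.mkHom ℂ _ t⁆ = 0
    rw [← LieHom.map_lie, hQ.lie_matrix_diagCocycles hf hrho (hTd ht), map_zero]
  · rintro _ ⟨y, hy, rfl⟩ M _ ⟨t, ht, rfl⟩ _ ⟨z, hz, rfl⟩ h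
    obtain ⟨f, hf, hM⟩ := hmk M
    rw [hM] at h
    obtain ⟨rfl, hM0, rfl, rfl⟩ := hQ.eq_zero_of_mkHom_eq_zero hI ha α
      (LinearMap.mem_ker.1 M.2) (hYd hy) hf (hTd ht) hz h
    exact ⟨map_zero _, Subtype.ext hM0, map_zero _, map_zero _⟩
  · intro x
    obtain ⟨y, hy, M, hM, f, hf, t, ht, z, hz, rfl⟩ :=
      hQ.exists_decomposition hI how ha α hT hY x
    refine ⟨_, ⟨y, hy, rfl⟩, ⟨M, LinearMap.mem_ker.2 hM⟩, _, ⟨t, ht, rfl⟩, _, ⟨z, hz, rfl⟩, ?_⟩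
    rw [map_add, map_add, map_add, ← arrowClass_eq hf]
    rfl
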